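/- \textbf{Setting.} Fix an observation $x$. Let $\Theta\subseteq\mathbb R^a$ and $\Phi\subseteq\mathbb R^b$ be open, let $\nu$ be a $\sigma$-finite Borel measure on $\mathbb R^d$, let $p_\theta(x,z)\ge 0$ ($\theta\in\Theta$) be a joint density and $q_\phi(z|x)\ge0$ ($\phi\in\Phi$) a variational density. Put $p_\theta(x)=\int p_\theta(x,z)\,\nu(dz)$, $p_\theta(z|x)=p_\theta(x,z)/p_\theta(x)$ and $w_{\theta,\phi}(z)=p_\theta(x,z)/q_\phi(z|x)$. Assume that for all $\theta\in\Theta$, $\phi\in\Phi$: $p_\theta(x)<\infty$, $\int q_\phi(z|x)\,\nu(dz)=1$, and $p_\theta(z|x),q_\phi(z|x)>0$ for $\nu$-a.e. $z$; that $\theta\mapsto p_\theta(x)$, $(z,\theta)\mapsto p_\theta(z|x)$ and $(z,\phi)\mapsto q_\phi(z|x)$ are differentiable on $\Theta$, $\mathbb R^d\times\Theta$ and $\mathbb R^d\times\Phi$; and that there are a probability law $Q$ and a function $f$ such that, for $\varepsilon\sim Q$, $f(\varepsilon,\phi)\sim q_\phi(\cdot|x)\,d\nu$ for every $\phi\in\Phi$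 and, almost surely, $\phi\mapsto f(\varepsilon,\phi)$ is differentiable on $\Phi$. Write $\tilde w_{\theta,\phi}(\varepsilon;\phi')=w_{\theta,\phi}(f(\varepsilon,\phi'))$, and assume that almost surely all these weights, $\theta\in\Theta$, $\phi,\phi'\in\Phi$, are well defined and positive, i.e. $p_\theta(x,f(\varepsilon,\phi'))>0$ and $q_\phi(f(\varepsilon,\phi')|x)>0$ (they are then differentiable in $(\theta,\phi,\phi')$). Let $\alpha\in[0,1)$, $(\theta,\phi)\in\Theta\times\Phi$, and let $\psi=\phi_k$ be a component of $\phi$; $\partial_{\psi}$ and $\partial_{\psi'}$ denote the partial derivatives with respect to the $k$-th component of $\phi$ and of $\phi'$. Let $\varepsilon_{m,j}$ ($m,j\ge1$) be i.i.d. with law $Q$, $Z_{m,j}=f(\varepsilon_{m,j},\phi)$ and $\lambda_{m,j}=w_{\theta,\phi}(Z_{m,j})^{1-\alpha}/\sum_{\ell=1}^N w_{\theta,\phi}(Z_{m,\ell})^{1-\alpha}$. The doubly-reparameterized (DREP) gradient estimator with respect to $\psi$ is $$G_{M,N}^{(\alpha)}=\frac1M\sum_{m=1}^M\sum_{j=1}^N\bigl(\alpha\lambda_{m,j}+(1-\alpha)\lambda_{m,j}^2\bigr)\,\partial_{\psi'}\log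 \tilde w_{\theta,\phi}(\varepsilon_{m,j};\phi')\big|_{\phi'=\phi}.$$ Put $\mathrm{SNR}[X]=|\mathbb E X|/\sqrt{\mathbb V X}$ and $$\mathrm{VR}^{(\alpha)}(\theta,\phi)=\tfrac1{1-\alpha}\log\mathbb E_{Z\sim q_\phi}\bigl(w_{\theta,\phi}(Z)^{1-\alpha}\bigr),\qquad \gamma^{(0)}(\theta,\phi)^2=\mathbb V_{Z\sim q_\phi}\Bigl(\frac{w_{\theta,\phi}(Z)}{\mathbb E_{Z'\sim q_\phi}w_{\theta,\phi}(Z')}\Bigr).$$ \textbf{Assumptions.} (i) There are $\mu>1$ and $n\ge1$ with $\mathbb E\bigl(|n^{-1}\sum_{j=1}^n\tilde w_{\theta,\phi}(\varepsilon_{1,j};\phi)^{1-\alpha}|^{-\mu}\bigr)<\infty$. (ii) $\mathbb E\bigl(\tilde w_{\theta,\phi}(\varepsilon;\phi)^{(1-\alpha)h}\bigr)<\infty$ for some $h>2$. (iii) $\mathbb E\bigl(|\partial_{\psi'}(\tilde w_{\theta,\phi}(\varepsilon;\phi')^{2(1-\alpha)})|_{\phi'=\phi}|^{\tilde h}\bigr)<\infty$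 for some $\tilde h>2$. (iv) (Domination.) Let $c=1-\alpha$ if $\alpha\in(0,1)$ and $c=2$ if $\alpha=0$. Every $(\theta,\phi)\in\Theta\times\Phi$ has a set $\mathcal V\subset\Theta\times\Phi$, containing all points obtained from $(\theta,\phi)$ by moving the single coordinate $\psi$ in some open interval centred at its value, such that $$\mathbb E\sup_{(\theta,\phi')\in\mathcal V}\bigl|\partial_{\psi'}\bigl(\tilde w_{\theta,\phi'}(\varepsilon;\phi')^{c}\bigr)\bigr|<\infty,\qquad \mathbb E\sup_{(\theta,\phi')\in\mathcal V}\bigl|\partial_{\psi'}\bigl(\tilde w_{\theta,\phi}(\varepsilon;\phi')^{c}\bigr)\bigr|<\infty,$$ $$\mathbb E_{Z\sim q_\phi}\Bigl(w_{\theta,\phi}(Z)^{c}\sup_{(\theta,\phi')\in\mathcal V}\Bigl|\partial_{\psi'}\bigl(\log q_{\phi'}(Z|x)\bigr)\frac{q_{\phi'}(Z|x)}{q_\phi(Z|x)}\Bigr|\Bigr)<\infty,$$ where $\mathbb E\sup|\cdots|<\infty$ means that the family is a.s. bounded by an integrable random variable. \textbf{Theorem 3.} Below, for $N$ large and all $M\ge1$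 the estimator is square integrable, the derivatives of $\mathrm{VR}^{(\alpha)}$ and of $\gamma^{(0)}(\cdot)^2$ exist, the variances $v$ are finite, and the $o(1)$ terms, as $N\to\infty$, do not depend on $M$. (1) If $\alpha\in(0,1)$ and, for some $h'>2$, $\mathbb E\bigl(|\partial_{\psi'}(\tilde w_{\theta,\phi}(\varepsilon;\phi')^{1-\alpha})|_{\phi'=\phi}|^{h'}\bigr)<\infty$, then, as $N\to\infty$, $$\mathrm{SNR}[G^{(\alpha)}_{M,N}]=\sqrt{MN}\,\frac{|\partial_\psi\mathrm{VR}^{(\alpha)}(\theta,\phi)+o(1)|}{\sqrt{v^{(\alpha)}}+o(1)},\qquad v^{(\alpha)}=\frac{\alpha^2}{(1-\alpha)^2}\,\mathbb V\Bigl(\partial_{\psi'}\Bigl(\frac{\tilde w_{\theta,\phi}(\varepsilon;\phi')^{1-\alpha}}{\mathbb E(\tilde w_{\theta,\phi}(\varepsilon;\phi')^{1-\alpha})}\Bigr)\Big|_{\phi'=\phi}\Bigr).$$ (2) If $\alpha=0$, then, as $N\to\infty$, $$\mathrm{SNR}[G^{(0)}_{M,N}]=\sqrt{MN}\,\frac{\bigl|\tfrac12\partial_\psi[\gamma^{(0)}(\theta,\phi)^2]+o(1)\bigr|}{\sqrt{v^{(0)}}+o(1)},$$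 $$v^{(0)}=\mathbb V\Bigl(\frac{\partial_{\psi'}(\tilde w_{\theta,\phi}(\varepsilon;\phi')^2)|_{\phi'=\phi}}{2\,\mathbb E(\tilde w_{\theta,\phi}(\varepsilon;\phi))^2}-\frac{\tilde w_{\theta,\phi}(\varepsilon;\phi)\,\mathbb E\bigl(\partial_{\psi'}(\tilde w_{\theta,\phi}(\varepsilon;\phi')^2)|_{\phi'=\phi}\bigr)}{\mathbb E(\tilde w_{\theta,\phi}(\varepsilon;\phi))^3}\Bigr).$$ Here the denominators $\sqrt{v}+o(1)$ are nonnegative, and quotients are taken in $[0,\infty]$, with $a/0=\infty$ for $a>0$ and $0/0=0$. -/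

import Mathlib

open MeasureTheory ProbabilityTheory Filter Topology

noncomputable section

namespace VarInf

/-- Partial derivative of `g` with respect to the `k`-th coordinate, at the point `y`. -/
def partialD {b : ℕ} (k : Fin b) (g : (Fin b → ℝ) → ℝ) (y : Fin b → ℝ) : ℝ :=
  deriv (fun t => g (Function.update y k t)) (y k)

/-- `g` has a partial derivative with respect to the `k`-th coordinate at the point `y`. -/
def HasPartialD {b : ℕ} (k : Fin b) (g : (Fin b → ℝ) → ℝ) (y : Fin b → ℝ) : Prop :=
  DifferentiableAt ℝ (fun t => g (Function.update y k t)) (y k)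

/-- The signal-to-noise ratio `|E X| / √(V X)`, with values in `[0, ∞]`
(so that it is `∞` when `V X = 0` and `E X ≠ 0`). -/
def snr {Ω : Type*} [MeasurableSpace Ω] (P : Measure Ω) (X : Ω → ℝ) : ENNReal :=
  ENNReal.ofReal |∫ ω, X ω ∂P| / ENNReal.ofReal (Real.sqrt (variance X P))

/-- The data of a reparameterized variational inference problem, for one fixed observation `x`
(which is therefore not displayed): parameter sets `Θ ⊆ ℝᵃ` and `Φ ⊆ ℝᵇ`, a dominating measure
`ν` on the latent space `ℝᵈ`, the joint density `p θ z = p_θ(x, z)`, the variational density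
`q φ z = q_φ(z | x)`, the law `Q` of the noise `ε` and the reparameterization map
`f ε φ = f(ε, φ; x)`. -/
structure Model (a b d : ℕ) (E : Type*) [MeasurableSpace E] where
  Θ : Set (Fin a → ℝ)
  Φ : Set (Fin b → ℝ)
  ν : Measure (Fin d → ℝ)
  p : (Fin a → ℝ) → (Fin d → ℝ) → ℝ
  q : (Fin b → ℝ) → (Fin d → ℝ) → ℝ
  Q : Measure E
  f : E → (Fin b → ℝ) → (Fin d → ℝ)

namespace Model

variable {a b d : ℕ} {E : Type*} [MeasurableSpace E] (S : Model a b d E)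

/-- The marginal likelihood `p_θ(x) = ∫ p_θ(x, z) ν(dz)`. -/
def evidence (θ : Fin a → ℝ) : ℝ := ∫ z, S.p θ z ∂S.ν

/-- The posterior density `p_θ(z | x) = p_θ(x, z) / p_θ(x)`. -/
def posterior (θ : Fin a → ℝ) (z : Fin d → ℝ) : ℝ := S.p θ z / S.evidence θ

/-- The probability distribution on `ℝᵈ` with density `q_φ(· | x)` with respect to `ν`. -/
def qLaw (φ : Fin b → ℝ) : Measure (Fin d → ℝ) :=
  S.ν.withDensity (fun z => ENNReal.ofReal (S.q φ z))

/-- The importance weight `w_{θ,φ}(z; x) = p_θ(x, z) / q_φ(z | x)`. -/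
def w (θ : Fin a → ℝ) (φ : Fin b → ℝ) (z : Fin d → ℝ) : ℝ := S.p θ z / S.q φ z

/-- The reparameterized weight `w_{θ,φ}(f(ε, φ'; x); x)`. -/
def wt (θ : Fin a → ℝ) (φ : Fin b → ℝ) (e : E) (φ' : Fin b → ℝ) : ℝ := S.w θ φ (S.f e φ')

/-- The standing assumptions on the model. -/
structure Standing : Prop where
  isOpen_Θ : IsOpen S.Θ
  isOpen_Φ : IsOpen S.Φ
  sigmaFinite : SigmaFinite S.ν
  p_nonneg : ∀ θ ∈ S.Θ, ∀ z, 0 ≤ S.p θ z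
  q_nonneg : ∀ φ ∈ S.Φ, ∀ z, 0 ≤ S.q φ z
  p_integrable : ∀ θ ∈ S.Θ, Integrable (S.p θ) S.ν
  q_integrable : ∀ φ ∈ S.Φ, Integrable (S.q φ) S.ν
  q_integral : ∀ φ ∈ S.Φ, ∫ z, S.q φ z ∂S.ν = 1
  posterior_pos : ∀ θ ∈ S.Θ, ∀ᵐ z ∂S.ν, 0 < S.posterior θ z
  q_pos : ∀ φ ∈ S.Φ, ∀ᵐ z ∂S.ν, 0 < S.q φ z
  evidence_diff : DifferentiableOn ℝ S.evidence S.Θ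
  posterior_diff : DifferentiableOn ℝ
    (fun y : (Fin d → ℝ) × (Fin a → ℝ) => S.posterior y.2 y.1) (Set.univ ×ˢ S.Θ)
  q_diff : DifferentiableOn ℝ
    (fun y : (Fin d → ℝ) × (Fin b → ℝ) => S.q y.2 y.1) (Set.univ ×ˢ S.Φ)
  isProb : IsProbabilityMeasure S.Q
  reparam : ∀ φ ∈ S.Φ, HasLaw (fun e => S.f e φ) (S.qLaw φ) S.Q
  f_diff : ∀ᵐ e ∂S.Q, DifferentiableOn ℝ (S.f e) S.Φ
  /-- Almost surely, all the weights `w_{θ,φ}(f(ε, φ'; x); x)` are well defined and positive;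
  with the conditions above, they are then differentiable in `(θ, φ, φ')`. -/
  weights_pos : ∀ᵐ e ∂S.Q, ∀ θ ∈ S.Θ, ∀ φ ∈ S.Φ, ∀ φ' ∈ S.Φ,
    0 < S.p θ (S.f e φ') ∧ 0 < S.q φ (S.f e φ')

/-- The variational Rényi bound of order `α`. -/
def VR (α : ℝ) (θ : Fin a → ℝ) (φ : Fin b → ℝ) : ℝ :=
  (1 / (1 - α)) * Real.log (∫ z, S.w θ φ z ^ (1 - α) ∂S.qLaw φ)

/-- The quantity `γ^{(α)}(θ, φ; x)²`. -/
def gammaSq (α : ℝ) (θ : Fin a → ℝ) (φ : Fin b → ℝ) : ℝ :=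
  (1 / (1 - α)) *
    variance (fun z => S.w θ φ z ^ (1 - α) / ∫ z', S.w θ φ z' ^ (1 - α) ∂S.qLaw φ) (S.qLaw φ)

/-- Normalized weight of the `j`-th of the `N` noise variables `e 0, …, e (N - 1)`. -/
def normWeight (α : ℝ) (θ : Fin a → ℝ) (φ : Fin b → ℝ) (N : ℕ) (e : ℕ → E) (j : ℕ) : ℝ :=
  S.wt θ φ (e j) φ ^ (1 - α) / ∑ l ∈ Finset.range N, S.wt θ φ (e l) φ ^ (1 - α)

/-- The doubly-reparameterized gradient estimator of the VR-IWAE bound with respect to `φ_k`,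
computed from the noise variables `e (m, j)`, `m < M`, `j < N`. -/
def drep (α : ℝ) (k : Fin b) (θ : Fin a → ℝ) (φ : Fin b → ℝ) (M N : ℕ) (e : ℕ × ℕ → E) : ℝ :=
  (1 / (M : ℝ)) * ∑ m ∈ Finset.range M, ∑ j ∈ Finset.range N,
    (α * S.normWeight α θ φ N (fun l => e (m, l)) j
        + (1 - α) * S.normWeight α θ φ N (fun l => e (m, l)) j ^ 2)
      * partialD k (fun φ' => Real.log (S.wt θ φ (e (m, j)) φ')) φ

/-- `V` is a `φ_k`-neighbourhood of `(θ, φ)`: it contains all the points obtained from `(θ, φ)` by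
moving the coordinate `φ_k` within some open interval centred at its value. -/
def IsCoordNhd (k : Fin b) (θ : Fin a → ℝ) (φ : Fin b → ℝ)
    (V : Set ((Fin a → ℝ) × (Fin b → ℝ))) : Prop :=
  ∃ r > 0, ∀ t ∈ Set.Ioo (φ k - r) (φ k + r), (θ, Function.update φ k t) ∈ V

/-- The three conditions `E (sup |…|) < ∞` over `(θ, φ') ∈ V`, with the exponent `c` on the weights.
Since a supremum over uncountably many `φ'` need not be measurable, `E (sup |…|) < ∞` is expressed
by the existence of an integrable upper bound. -/
def DominatedOn (c : ℝ) (k : Fin b) (θ : Fin a → ℝ) (φ : Fin b → ℝ)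
    (V : Set ((Fin a → ℝ) × (Fin b → ℝ))) : Prop :=
  (∃ G : E → ℝ, Integrable G S.Q ∧ ∀ᵐ e ∂S.Q, ∀ φ', (θ, φ') ∈ V →
    |partialD k (fun φ'' => S.wt θ φ'' e φ'' ^ c) φ'| ≤ G e) ∧
  (∃ G : E → ℝ, Integrable G S.Q ∧ ∀ᵐ e ∂S.Q, ∀ φ', (θ, φ') ∈ V →
    |partialD k (fun φ'' => S.wt θ φ e φ'' ^ c) φ'| ≤ G e) ∧
  (∃ G : (Fin d → ℝ) → ℝ, Integrable G (S.qLaw φ) ∧ ∀ᵐ z ∂S.qLaw φ, ∀ φ', (θ, φ') ∈ V →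
    S.w θ φ z ^ c *
      |partialD k (fun φ'' => Real.log (S.q φ'' z)) φ' * (S.q φ' z / S.q φ z)| ≤ G z)

/-- The domination condition for the doubly-reparameterized estimator with respect to `φ_k`. The
weights carry the exponent `1 - α` when `α ∈ (0, 1)`, and the exponent `2` when `α = 0`. -/
def DrepDomination (α : ℝ) (k : Fin b) : Prop :=
  ∀ θ ∈ S.Θ, ∀ φ ∈ S.Φ, ∃ V ⊆ S.Θ ×ˢ S.Φ, IsCoordNhd k θ φ V ∧
    (0 < α → S.DominatedOn (1 - α) k θ φ V) ∧
    (α = 0 → S.DominatedOn 2 k θ φ V)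

/-- The random variable `∂_{φ'_k} (w_{θ,φ}(f(ε, φ'))^{1-α} / E (w_{θ,φ}(f(ε, φ'))^{1-α}))`,
evaluated at `φ' = φ`, as a function of the noise. -/
def drepVar (α : ℝ) (k : Fin b) (θ : Fin a → ℝ) (φ : Fin b → ℝ) (e : E) : ℝ :=
  partialD k (fun φ' => S.wt θ φ e φ' ^ (1 - α) / ∫ e', S.wt θ φ e' φ' ^ (1 - α) ∂S.Q) φ

/-- The asymptotic variance of the estimator for `α ∈ (0, 1)`. -/
def vDrep (α : ℝ) (k : Fin b) (θ : Fin a → ℝ) (φ : Fin b → ℝ) : ℝ :=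
  α ^ 2 / (1 - α) ^ 2 * variance (S.drepVar α k θ φ) S.Q

/-- The random variable whose variance is the asymptotic variance for `α = 0`. -/
def drepVarZero (k : Fin b) (θ : Fin a → ℝ) (φ : Fin b → ℝ) (e : E) : ℝ :=
  partialD k (fun φ' => S.wt θ φ e φ' ^ (2 : ℝ)) φ / (2 * (∫ e', S.wt θ φ e' φ ∂S.Q) ^ 2)
    - S.wt θ φ e φ * (∫ e', partialD k (fun φ' => S.wt θ φ e' φ' ^ (2 : ℝ)) φ ∂S.Q)
      / (∫ e', S.wt θ φ e' φ ∂S.Q) ^ 3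

/-- The asymptotic variance of the estimator for `α = 0`. -/
def vDrepZero (k : Fin b) (θ : Fin a → ℝ) (φ : Fin b → ℝ) : ℝ :=
  variance (S.drepVarZero k θ φ) S.Q

end Model

end VarInf

end

/-! Write `X = w^(1-α)`, `D = ∂ log w̃`, `A = X D`, `B = X² D`, with means `x`, `a`, `b` of `X`,
`A`, `B`. One row of the estimator is `α ΣA/ΣX + (1-α) ΣB/(ΣX)²`, a smooth function of empirical
means, and the theorem is a delta method for it that holds for means and variances, not merely in
law.

For `α > 0` the second term is of order `1/N`. The ratio `ΣA/ΣX` linearizes to `a/x` plus the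
empirical mean of `(A - (a/x) X)/x`. For `α = 0` only the second term is left; the SNR does not see
a positive factor, so the row is multiplied by `N`, and `N ΣB/(ΣX)²` linearizes around `b/x²`. The
expansions are exact identities, and a remainder that tends to `0` in `L²` changes neither the limit
of the mean nor that of `N` times the variance (`asymptotics_of_linear_add`).

The remainders are normalized sums times a function of `S = ΣX/N` that blows up at most like `S⁻²`
at `0`. Where `S ≥ x/2` this function is bounded and small in mean, while squares of normalized sums
are uniformly integrable (`tendsto_integral_sq_mul`). Where `S < x/2`, the factor `S⁻⁴` is paid for
by four disjoint blocks of `n` variables with a finite inverse moment, and the other variables give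
a Chernoff bound exponentially small in `N` (`tendsto_lintegral_sq_mul_inv_pow_four`).

It remains to recognize the limits as derivatives (`hasDerivAt_moments`). Let `β` be the mean of
`∂_{ψ'} w̃^c`. Moving `φ'` in `E w̃^c` amounts, by change of measure, to moving the density `q_φ'`
with `w` fixed, so `β` is also the mean of `w^c ∂ log q`. Moving `φ` inside the weight contributes
`-c w^c ∂ log q`, hence the total derivative of `E w^c` is `(1-c) β`. With `c = 1-α` this gives `∂VR
= α a/x`; with `c = 2`, as `E w` is the evidence and does not depend on `φ`, it gives `½ ∂γ² =
-b/x²`, which has the right absolute value.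

Averaging `M` independent rows keeps the mean and divides the variance by `M` (`average_rows`,
`exists_snr_eq`), so the error terms do not involve `M`. -/

namespace VarInf

/-! ### I.i.d. families and uniform integrability of normalized sums -/

/-- The family `ε` is independent, and each of its members is measurable with law `Q`. -/
structure IsIID {ι Ω E : Type*} [MeasurableSpace Ω] [MeasurableSpace E]
    (ε : ι → Ω → E) (Q : Measure E) (P : Measure Ω) : Prop where
  meas : ∀ i, Measurable (ε i)
  indep : iIndepFun ε P
  map_eq : ∀ i, P.map (ε i) = Q

lemma eLpNorm_two_sq {Ω : Type*} [MeasurableSpace Ω] {μ : Measure Ω} (f : Ω → ℝ) :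
    eLpNorm f 2 μ ^ 2 = ∫⁻ ω, ENNReal.ofReal (f ω ^ 2) ∂μ := by
  have h := eLpNorm_nnreal_pow_eq_lintegral (p := 2) (μ := μ) (f := f) (by norm_num)
  simp only [NNReal.coe_ofNat, ENNReal.coe_ofNat, ENNReal.rpow_ofNat] at h
  rw [h]
  refine lintegral_congr fun ω => ?_
  rw [← sq_abs, ENNReal.ofReal_pow (abs_nonneg _), ← Real.enorm_eq_ofReal_abs]

lemma eLpNorm_two_sq_of_memLp {Ω : Type*} [MeasurableSpace Ω] {μ : Measure Ω} {f : Ω → ℝ}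
    (hf : MemLp f 2 μ) : eLpNorm f 2 μ ^ 2 = ENNReal.ofReal (∫ ω, f ω ^ 2 ∂μ) := by
  rw [eLpNorm_two_sq, ofReal_integral_eq_lintegral_ofReal hf.integrable_sq
    (Eventually.of_forall fun ω => sq_nonneg (f ω))]

namespace IsIID

variable {ι κ Ω E : Type*} [MeasurableSpace Ω] [MeasurableSpace E] {ε : ι → Ω → E}
  {Q : Measure E} {P : Measure Ω}

lemma precomp (hε : IsIID ε Q P) {u : κ → ι} (hu : u.Injective) :
    IsIID (fun i => ε (u i)) Q P :=
  ⟨fun i => hε.meas (u i), hε.indep.precomp hu, fun i => hε.map_eq (u i)⟩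

lemma map_tuple [IsProbabilityMeasure P] (hε : IsIID ε Q P) {n : ℕ} {u : Fin n → ι}
    (hu : u.Injective) :
    P.map (fun ω i => ε (u i) ω) = Measure.pi (fun _ : Fin n => Q) := by
  have h := (hε.precomp hu).indep
  rw [iIndepFun_iff_map_fun_eq_pi_map (fun i => (hε.meas (u i)).aemeasurable)] at h
  rw [h]
  simp only [hε.map_eq]

lemma measurePreserving (hε : IsIID ε Q P) (i : ι) : MeasurePreserving (ε i) P Q :=
  ⟨hε.meas i, hε.map_eq i⟩

lemma integral_comp (hε : IsIID ε Q P) (i : ι) {f : E → ℝ} (hf : Measurable f) :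
    ∫ ω, f (ε i ω) ∂P = ∫ e, f e ∂Q := by
  rw [← hε.map_eq i, integral_map (hε.meas i).aemeasurable hf.aestronglyMeasurable]

lemma lintegral_comp (hε : IsIID ε Q P) (i : ι) {f : E → ENNReal} (hf : Measurable f) :
    ∫⁻ ω, f (ε i ω) ∂P = ∫⁻ e, f e ∂Q := by
  rw [← hε.map_eq i, lintegral_map hf (hε.meas i)]

lemma memLp_comp (hε : IsIID ε Q P) (i : ι) {f : E → ℝ} {p : ENNReal} (hf : MemLp f p Q) :
    MemLp (fun ω => f (ε i ω)) p P :=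
  hf.comp_measurePreserving (hε.measurePreserving i)

lemma indep_comp (hε : IsIID ε Q P) {f : E → ℝ} (hf : Measurable f) :
    iIndepFun (fun i ω => f (ε i ω)) P :=
  hε.indep.comp (fun _ => f) (fun _ => hf)

/-- The second moment of a sum of i.i.d. centred variables. -/
lemma integral_sum_sq [IsProbabilityMeasure P] (hε : IsIID ε Q P) {f : E → ℝ}
    (hf : Measurable f) (hf2 : MemLp f 2 Q) (hf0 : ∫ e, f e ∂Q = 0) (s : Finset ι) :
    ∫ ω, (∑ i ∈ s, f (ε i ω)) ^ 2 ∂P = s.card * ∫ e, f e ^ 2 ∂Q := by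
  have hL : ∀ i ∈ s, MemLp (fun ω => f (ε i ω)) 2 P := fun i _ => hε.memLp_comp i hf2
  have h1 := IndepFun.variance_sum hL
    (fun i _ j _ hij => (hε.indep_comp hf).indepFun hij)
  have hz : ∀ i, ∫ ω, f (ε i ω) ∂P = 0 := fun i => by rw [hε.integral_comp i hf, hf0]
  have hI : ∀ i ∈ s, Integrable (fun ω => f (ε i ω)) P :=
    fun i hi => (hL i hi).integrable (by norm_num)
  have hz' : ∫ ω, (∑ i ∈ s, fun ω => f (ε i ω)) ω ∂P = 0 := by
    simp only [Finset.sum_apply]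
    rw [integral_finsetSum _ hI]
    simp [hz]
  have hm : AEMeasurable (∑ i ∈ s, fun ω => f (ε i ω)) P :=
    Finset.aemeasurable_sum _ fun i _ => (hf.comp (hε.meas i)).aemeasurable
  rw [variance_of_integral_eq_zero hm hz'] at h1
  simp only [Finset.sum_apply] at h1
  rw [h1, Finset.sum_congr rfl (g := fun _ => ∫ e, f e ^ 2 ∂Q)]
  · simp
  · intro i _
    refine (variance_of_integral_eq_zero (hf.comp (hε.meas i)).aemeasurable (hz i)).trans ?_
    exact hε.integral_comp i (hf.pow_const 2)

/-- Normalized sums of bounded centred i.i.d. variables have bounded fourth moments. -/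
lemma integral_sum_pow_four_le [IsProbabilityMeasure P] (hε : IsIID ε Q P) {f : E → ℝ}
    (hf : Measurable f) {K : ℝ} (hK : ∀ e, |f e| ≤ K) (hf0 : ∫ e, f e ∂Q = 0) :
    ∃ C : ℝ, ∀ s : Finset ι, Integrable (fun ω => ((∑ i ∈ s, f (ε i ω)) / √s.card) ^ 4) P ∧
      ∫ ω, ((∑ i ∈ s, f (ε i ω)) / √s.card) ^ 4 ∂P ≤ C := by
  -- The variance proxy of Hoeffding's lemma on `[-K, K]`. At the scale `t = 1/√card` the moment
  -- generating function of the sum is bounded independently of `s`, and `u⁴ ≤ 24 (eᵘ + e⁻ᵘ)` turns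
  -- this into the fourth moment bound.
  obtain ⟨c, hc⟩ : ∃ c : NNReal, c = (‖K - (-K)‖₊ / 2) ^ 2 := ⟨_, rfl⟩
  refine ⟨48 * Real.exp (c / 2), fun s => ?_⟩
  have hsub : HasSubgaussianMGF (fun ω => ∑ i ∈ s, f (ε i ω)) (∑ _i ∈ s, c) P := by
    refine HasSubgaussianMGF.sum_of_iIndepFun (hε.indep_comp hf) (fun i _ => ?_)
    rw [hc]
    refine hasSubgaussianMGF_of_mem_Icc_of_integral_eq_zero (hf.comp (hε.meas i)).aemeasurable
      (Eventually.of_forall fun ω => ?_) ?_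
    · exact abs_le.1 (hK _)
    · exact (hε.integral_comp i hf).trans hf0
  have hmgf : ∀ t : ℝ, t ^ 2 * s.card ≤ 1 →
      ∫ ω, Real.exp (t * ∑ i ∈ s, f (ε i ω)) ∂P ≤ Real.exp (c / 2) := by
    intro t ht
    refine (hsub.mgf_le t).trans (Real.exp_le_exp.2 ?_)
    simp only [Finset.sum_const, nsmul_eq_mul, NNReal.coe_mul, NNReal.coe_natCast]
    have : (0 : ℝ) ≤ c := c.2
    nlinarith
  set t : ℝ := (√s.card)⁻¹ with ht
  have ht1 : t ^ 2 * s.card ≤ 1 := by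
    rw [ht, inv_pow, Real.sq_sqrt (Nat.cast_nonneg _)]
    exact inv_mul_le_one
  have hpt : ∀ u : ℝ, u ^ 4 ≤ 24 * (Real.exp u + Real.exp (-u)) := by
    have h1 : ∀ v : ℝ, 0 ≤ v → v ^ 4 ≤ 24 * Real.exp v := by
      intro v hv
      have := Real.pow_div_factorial_le_exp v hv 4
      norm_num [Nat.factorial] at this
      linarith
    intro u
    have h2 := Real.exp_pos u
    have h3 := Real.exp_pos (-u)
    rcases le_total 0 u with hu | hu
    · linarith [h1 u hu]
    · have := h1 (-u) (by linarith)
      rw [(by decide : Even 4).neg_pow] at this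
      linarith
  have hm : Measurable (fun ω => ∑ i ∈ s, f (ε i ω)) :=
    Finset.measurable_fun_sum _ fun i _ => hf.comp (hε.meas i)
  have hint : Integrable (fun ω => 24 * (Real.exp (t * ∑ i ∈ s, f (ε i ω))
      + Real.exp (-t * ∑ i ∈ s, f (ε i ω)))) P :=
    ((hsub.integrable_exp_mul t).add (hsub.integrable_exp_mul (-t))).const_mul 24
  have hle : ∀ ω, ((∑ i ∈ s, f (ε i ω)) / √s.card) ^ 4 ≤
      24 * (Real.exp (t * ∑ i ∈ s, f (ε i ω)) + Real.exp (-t * ∑ i ∈ s, f (ε i ω))) := by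
    intro ω
    rw [div_eq_inv_mul, neg_mul]
    exact hpt _
  have hint4 : Integrable (fun ω => ((∑ i ∈ s, f (ε i ω)) / √s.card) ^ 4) P := by
    refine hint.mono' ((hm.div_const _).pow_const 4).aestronglyMeasurable
      (Eventually.of_forall fun ω => ?_)
    rw [Real.norm_of_nonneg (by positivity)]
    exact hle ω
  refine ⟨hint4, (integral_mono hint4 hint hle).trans ?_⟩
  rw [integral_const_mul,
    integral_add (hsub.integrable_exp_mul t) (hsub.integrable_exp_mul (-t))]
  have h1 := hmgf t ht1
  have h2 := hmgf (-t) (by rwa [neg_sq])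
  linarith

/-- A squared normalized sum of i.i.d. centred square integrable variables, multiplied by a
bounded sequence that goes to `0` in mean, goes to `0` in mean. -/
theorem tendsto_integral_sq_mul [IsProbabilityMeasure P] [IsProbabilityMeasure Q] {ε : ℕ → Ω → E}
    (hε : IsIID ε Q P) {f : E → ℝ}
    (hf : Measurable f) (hf2 : MemLp f 2 Q) (hf0 : ∫ e, f e ∂Q = 0)
    {g : ℕ → Ω → ℝ} (hg : ∀ N, Measurable (g N)) {C : ℝ} (hg0 : ∀ N ω, 0 ≤ g N ω)
    (hgC : ∀ N ω, g N ω ≤ C) (hlim : Tendsto (fun N => ∫ ω, g N ω ∂P) atTop (𝓝 0)) :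
    Tendsto (fun N : ℕ => ∫ ω, ((∑ i ∈ Finset.range N, f (ε i ω)) / √N) ^ 2 * g N ω ∂P)
      atTop (𝓝 0) := by
  have hC : 0 ≤ C := by
    obtain ⟨ω⟩ := nonempty_of_isProbabilityMeasure P
    exact (hg0 0 ω).trans (hgC 0 ω)
  have hgint : ∀ N, Integrable (g N) P := fun N =>
    Integrable.of_mem_Icc 0 C (hg N).aemeasurable (Eventually.of_forall fun ω => ⟨hg0 N ω, hgC N ω⟩)
  have hsqint : ∀ {f' : E → ℝ}, MemLp f' 2 Q → ∀ N : ℕ,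
      Integrable (fun ω => ((∑ i ∈ Finset.range N, f' (ε i ω)) / √N) ^ 2) P := by
    intro f' hf' N
    have : MemLp (fun ω => (∑ i ∈ Finset.range N, f' (ε i ω)) / √N) 2 P := by
      simp only [div_eq_mul_inv]
      exact (memLp_finsetSum _ fun i _ => hε.memLp_comp i hf').mul_const _
    exact this.integrable_sq
  have hnn : ∀ N : ℕ, 0 ≤ ∫ ω, ((∑ i ∈ Finset.range N, f (ε i ω)) / √N) ^ 2 * g N ω ∂P :=
    fun N => integral_nonneg fun ω => mul_nonneg (sq_nonneg _) (hg0 N ω)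
  -- for every `δ`, a bound that is eventually at most `(2 * C + 2) * δ`
  have key : ∀ δ : ℝ, 0 < δ → ∀ᶠ N : ℕ in atTop,
      ∫ ω, ((∑ i ∈ Finset.range N, f (ε i ω)) / √N) ^ 2 * g N ω ∂P ≤ (2 * C + 2) * δ := by
    intro δ hδ
    -- Split `f` into a bounded centred part `f₁`, whose normalized sums have bounded fourth
    -- moments, and a part `f₂` whose normalized sums have second moment at most `δ`.
    obtain ⟨g₀, hg₀, hg₀L⟩ := hf2.exists_simpleFunc_eLpNorm_sub_lt (by norm_num)
      (ε := ENNReal.ofReal (√δ)) (by simpa using hδ)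
    set b : ℝ := ∫ e, g₀ e ∂Q with hb
    have hg₀int : Integrable g₀ Q := hg₀L.integrable (by norm_num)
    set f₁ : E → ℝ := fun e => g₀ e - b with hf₁
    set f₂ : E → ℝ := fun e => f e - f₁ e with hf₂
    have hf₁m : Measurable f₁ := g₀.measurable.sub_const b
    have hf₂m : Measurable f₂ := hf.sub hf₁m
    have hf₁L : MemLp f₁ 2 Q := hg₀L.sub (memLp_const b)
    have hf₂L : MemLp f₂ 2 Q := hf2.sub hf₁L
    have hf₁0 : ∫ e, f₁ e ∂Q = 0 := by
      rw [hf₁, integral_sub hg₀int (integrable_const b)]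
      simp [hb]
    have hf₂0 : ∫ e, f₂ e ∂Q = 0 := by
      rw [hf₂, integral_sub (hf2.integrable (by norm_num)) (hf₁L.integrable (by norm_num)),
        hf0, hf₁0, sub_zero]
    obtain ⟨K, hK⟩ : ∃ K, ∀ e, |f₁ e| ≤ K := by
      obtain ⟨K, hK⟩ := g₀.exists_forall_norm_le
      refine ⟨K + |b|, fun e => (abs_sub _ _).trans (by gcongr; exact hK e)⟩
    have hf₂sq : ∫ e, f₂ e ^ 2 ∂Q ≤ δ := by
      have hsub : MemLp (f - ⇑g₀) 2 Q := hf2.sub hg₀L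
      have h1 : ∫ e, (f - ⇑g₀) e ^ 2 ∂Q ≤ δ := by
        have h2 : ENNReal.ofReal (∫ e, (f - ⇑g₀) e ^ 2 ∂Q) ≤ ENNReal.ofReal δ := by
          rw [← eLpNorm_two_sq_of_memLp hsub, ← Real.sq_sqrt hδ.le,
            ENNReal.ofReal_pow (Real.sqrt_nonneg δ)]
          gcongr
        exact (ENNReal.ofReal_le_ofReal_iff hδ.le).1 h2
      -- Recentring does not enlarge the second moment: `f₂` is `f - g₀` minus its mean.
      have h2 : ∫ e, f₂ e ^ 2 ∂Q = variance (f - ⇑g₀) Q := by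
        rw [variance_eq_integral hsub.aestronglyMeasurable.aemeasurable]
        refine integral_congr_ae (Eventually.of_forall fun e => ?_)
        have : ∫ e, (f - ⇑g₀) e ∂Q = -b := by
          simp only [Pi.sub_apply]
          rw [integral_sub (hf2.integrable (by norm_num)) hg₀int, hf0, zero_sub]
        rw [this]
        simp only [hf₂, hf₁, Pi.sub_apply]
        ring
      rw [h2]
      exact (variance_le_expectation_sq hsub.aestronglyMeasurable).trans h1
    obtain ⟨D, hD⟩ := hε.integral_sum_pow_four_le hf₁m hK hf₁0
    -- This weight makes the fourth moment cost at most `δ` in `2 U₁² g ≤ η U₁⁴ + g²/η`; the other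
    -- term is at most `(C/η) g`, which vanishes in mean for fixed `η`.
    set η : ℝ := δ / (|D| + 1) with hη
    have hη0 : 0 < η := by positivity
    have hηD : η * D ≤ δ := by
      rw [hη, div_mul_eq_mul_div, div_le_iff₀ (by positivity)]
      have := le_abs_self D
      nlinarith
    have hev : ∀ᶠ N in atTop, C / η * ∫ ω, g N ω ∂P < δ := by
      have : Tendsto (fun N => C / η * ∫ ω, g N ω ∂P) atTop (𝓝 0) := by
        simpa using hlim.const_mul (C / η)
      exact this.eventually (gt_mem_nhds hδ)
    filter_upwards [hev, eventually_ge_atTop 1] with N hN hN1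
    have hN0 : (0 : ℝ) < N := by exact_mod_cast hN1
    set U₁ : Ω → ℝ := fun ω => (∑ i ∈ Finset.range N, f₁ (ε i ω)) / √N with hU₁
    set U₂ : Ω → ℝ := fun ω => (∑ i ∈ Finset.range N, f₂ (ε i ω)) / √N with hU₂
    have h4 := hD (Finset.range N)
    rw [Finset.card_range] at h4
    have hU₂sq : ∫ ω, U₂ ω ^ 2 ∂P ≤ δ := by
      simp only [hU₂, div_pow, Real.sq_sqrt hN0.le]
      rw [integral_div, hε.integral_sum_sq hf₂m hf₂L hf₂0, Finset.card_range,
        mul_div_cancel_left₀ _ hN0.ne']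
      exact hf₂sq
    have hU : ∀ ω, (∑ i ∈ Finset.range N, f (ε i ω)) / √N = U₁ ω + U₂ ω := by
      intro ω
      rw [hU₁, hU₂, ← add_div, ← Finset.sum_add_distrib]
      simp [hf₂]
    have hI1 : Integrable (fun ω => η * U₁ ω ^ 4 + C / η * g N ω) P :=
      (h4.1.const_mul η).add ((hgint N).const_mul _)
    have hI2 : Integrable (fun ω => 2 * C * U₂ ω ^ 2) P := (hsqint hf₂L N).const_mul _
    calc ∫ ω, ((∑ i ∈ Finset.range N, f (ε i ω)) / √N) ^ 2 * g N ω ∂P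
        ≤ ∫ ω, (η * U₁ ω ^ 4 + C / η * g N ω) + 2 * C * U₂ ω ^ 2 ∂P := by
          refine integral_mono_of_nonneg
            (Eventually.of_forall fun ω => mul_nonneg (sq_nonneg _) (hg0 N ω)) (hI1.add hI2)
            (Eventually.of_forall fun ω => ?_)
          simp only [hU]
          have h1 : 2 * U₁ ω ^ 2 * g N ω ≤ η * U₁ ω ^ 4 + g N ω ^ 2 / η := by
            have : 0 ≤ (η * U₁ ω ^ 2 - g N ω) ^ 2 / η := by positivity
            have h' : (η * U₁ ω ^ 2 - g N ω) ^ 2 / η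
              = η * U₁ ω ^ 4 + g N ω ^ 2 / η - 2 * U₁ ω ^ 2 * g N ω := by
              field_simp
              ring
            linarith
          have h2 : g N ω ^ 2 / η ≤ C / η * g N ω := by
            rw [div_mul_eq_mul_div, sq]
            gcongr
            · exact hg0 N ω
            · exact hgC N ω
          have h3 : 2 * U₂ ω ^ 2 * g N ω ≤ 2 * C * U₂ ω ^ 2 := by
            have := mul_le_mul_of_nonneg_left (hgC N ω) (sq_nonneg (U₂ ω))
            linarith
          have h5 : (U₁ ω + U₂ ω) ^ 2 * g N ω ≤ (2 * U₁ ω ^ 2 + 2 * U₂ ω ^ 2) * g N ω := by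
            refine mul_le_mul_of_nonneg_right ?_ (hg0 N ω)
            linarith [sq_nonneg (U₁ ω - U₂ ω)]
          linarith
      _ = (η * ∫ ω, U₁ ω ^ 4 ∂P + C / η * ∫ ω, g N ω ∂P) + 2 * C * ∫ ω, U₂ ω ^ 2 ∂P := by
          rw [integral_add hI1 hI2, integral_add (h4.1.const_mul η) ((hgint N).const_mul _),
            integral_const_mul, integral_const_mul, integral_const_mul]
      _ ≤ (δ + δ) + 2 * C * δ := by
          have := mul_le_mul_of_nonneg_left h4.2 hη0.le
          gcongr
          exact this.trans hηD
      _ = (2 * C + 2) * δ := by ring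
  rw [Metric.tendsto_nhds]
  intro r hr
  have h2 : 0 < 2 * C + 3 := by linarith
  filter_upwards [key (r / (2 * C + 3)) (div_pos hr h2)] with N hN
  rw [Real.dist_eq, sub_zero, abs_of_nonneg (hnn N)]
  refine hN.trans_lt ?_
  rw [mul_div_assoc', div_lt_iff₀ h2]
  nlinarith

end IsIID
end VarInf

/-! ### Independent blocks and the lower tail of the empirical mean -/

namespace VarInf
namespace IsIID

variable {ι κ Ω E : Type*} [mE : MeasurableSpace E] {ε : ι → Ω → E}

lemma measurable_iSup_comap {S : Set ι} {i : ι} (hi : i ∈ S) {α : Type*} [MeasurableSpace α]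
    {f : E → α} (hf : Measurable f) :
    Measurable[⨆ j ∈ S, mE.comap (ε j)] (fun ω => f (ε i ω)) :=
  (hf.comp (comap_measurable (ε i))).mono
    (le_iSup₂_of_le (f := fun j (_ : j ∈ S) => mE.comap (ε j)) i hi le_rfl) le_rfl

variable [MeasurableSpace Ω] {Q : Measure E} {P : Measure Ω}

lemma iSup_comap_le (hε : IsIID ε Q P) (S : Set ι) :
    (⨆ j ∈ S, mE.comap (ε j)) ≤ (inferInstance : MeasurableSpace Ω) :=
  iSup₂_le fun j _ => (hε.meas j).comap_le

lemma lintegral_mul_of_disjoint (hε : IsIID ε Q P) {S T : Set ι} (hST : Disjoint S T)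
    {F G : Ω → ENNReal} (hF : Measurable[⨆ j ∈ S, mE.comap (ε j)] F)
    (hG : Measurable[⨆ j ∈ T, mE.comap (ε j)] G) :
    ∫⁻ ω, F ω * G ω ∂P = (∫⁻ ω, F ω ∂P) * ∫⁻ ω, G ω ∂P :=
  lintegral_mul_eq_lintegral_mul_lintegral_of_independent_measurableSpace
    (hε.iSup_comap_le S) (hε.iSup_comap_le T)
    (indep_iSup_of_disjoint (fun j => (hε.meas j).comap_le) hε.indep hST) hF hG

lemma lintegral_tuple [IsProbabilityMeasure P] (hε : IsIID ε Q P) {n : ℕ} {u : Fin n → ι}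
    (hu : u.Injective) {F : (Fin n → E) → ENNReal} (hF : Measurable F) :
    ∫⁻ ω, F (fun i => ε (u i) ω) ∂P = ∫⁻ y, F y ∂Measure.pi (fun _ => Q) := by
  rw [← hε.map_tuple hu, lintegral_map hF (measurable_pi_lambda _ fun i => hε.meas (u i))]

/-- The law of such a sum depends only on the number of distinct indices. This serves to move blocks
to the origin and to undo transpositions of indices. -/
lemma lintegral_sum_comp [IsProbabilityMeasure P] {ε : ℕ → Ω → E} (hε : IsIID ε Q P) (n : ℕ)
    {u : ℕ → ℕ} (hu : u.Injective) {X : E → ℝ} (hX : Measurable X) {H : ℝ → ENNReal}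
    (hH : Measurable H) :
    ∫⁻ ω, H (∑ l ∈ Finset.range n, X (ε (u l) ω)) ∂P =
      ∫⁻ ω, H (∑ l ∈ Finset.range n, X (ε l ω)) ∂P := by
  simp only [Finset.sum_range]
  have hF : Measurable (fun y : Fin n → E => H (∑ l, X (y l))) :=
    hH.comp (Finset.measurable_fun_sum _ fun i _ => hX.comp (measurable_pi_apply i))
  rw [hε.lintegral_tuple (u := fun i : Fin n => u i) (hu.comp Fin.val_injective) hF,
    hε.lintegral_tuple (u := fun i : Fin n => (i : ℕ)) Fin.val_injective hF]

/-- Integral of a product of a function of the first `a` variables with `m` functions of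
consecutive blocks of `n` variables. -/
lemma lintegral_mul_prod_blocks [IsProbabilityMeasure P] {ε : ℕ → Ω → E} (hε : IsIID ε Q P)
    {a : ℕ} {F : Ω → ENNReal} (hF : Measurable[⨆ j ∈ Set.Iio a, mE.comap (ε j)] F) (n m : ℕ)
    {X : E → ℝ} (hX : Measurable X) {H : ℝ → ENNReal} (hH : Measurable H) :
    Measurable[⨆ j ∈ Set.Iio (a + m * n), mE.comap (ε j)]
      (fun ω => F ω * ∏ k ∈ Finset.range m, H (∑ l ∈ Finset.range n, X (ε (a + k * n + l) ω))) ∧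
    ∫⁻ ω, F ω * ∏ k ∈ Finset.range m, H (∑ l ∈ Finset.range n, X (ε (a + k * n + l) ω)) ∂P =
      (∫⁻ ω, F ω ∂P) * (∫⁻ ω, H (∑ l ∈ Finset.range n, X (ε l ω)) ∂P) ^ m := by
  -- Measurability with respect to the variables already consumed is carried along, since it is what
  -- makes the next block independent of them.
  induction m with
  | zero =>
    refine ⟨?_, by simp⟩
    simp only [Finset.range_zero, Finset.prod_empty, mul_one]
    rwa [zero_mul, add_zero]
  | succ m ih =>
    have hG : ∀ S : Set ℕ, (∀ l < n, a + m * n + l ∈ S) → Measurable[⨆ j ∈ S, mE.comap (ε j)]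
        (fun ω => H (∑ l ∈ Finset.range n, X (ε (a + m * n + l) ω))) := by
      intro S hS
      exact hH.comp (Finset.measurable_fun_sum _ fun l hl =>
        measurable_iSup_comap (hS l (Finset.mem_range.1 hl)) hX)
    simp only [Finset.prod_range_succ, ← mul_assoc]
    constructor
    · refine Measurable.mul (ih.1.mono ?_ le_rfl) (hG _ fun l hl => ?_)
      · refine biSup_mono fun j hj => Set.mem_Iio.2 (lt_of_lt_of_le (Set.mem_Iio.1 hj) ?_)
        gcongr
        omega
      · simp only [Set.mem_Iio, Nat.succ_mul]
        omega
    · have hdisj : Disjoint (Set.Iio (a + m * n)) (Set.Ici (a + m * n)) :=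
        Set.disjoint_left.2 fun j hj hj' => absurd (Set.mem_Iio.1 hj) (not_lt.2 (Set.mem_Ici.1 hj'))
      rw [hε.lintegral_mul_of_disjoint hdisj ih.1
        (hG _ fun l _ => Set.mem_Ici.2 (Nat.le_add_right _ _)), ih.2, pow_succ,
        hε.lintegral_sum_comp n (add_right_injective (a + m * n)) hX hH, mul_assoc]

end IsIID

/-- The Laplace transform of a nonnegative square integrable variable near `0`. -/
lemma exists_integral_exp_neg_le {E : Type*} [MeasurableSpace E] {Q : Measure E}
    [IsProbabilityMeasure Q] {X : E → ℝ} (hX0 : ∀ e, 0 < X e)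
    (hX2 : MemLp X 2 Q) (hx : 0 < ∫ e, X e ∂Q) :
    ∃ t : ℝ, 0 < t ∧ ∫⁻ e, ENNReal.ofReal (Real.exp (-t * X e)) ∂Q
      ≤ ENNReal.ofReal (Real.exp (-(3 / 4 * t * ∫ e, X e ∂Q))) := by
  set x := ∫ e, X e ∂Q
  set y := ∫ e, X e ^ 2 ∂Q
  have hy : 0 ≤ y := integral_nonneg fun e => sq_nonneg _
  -- With this `t` one has `t y ≤ x/2`, so `1 - t x + t² y/2 ≤ 1 - (3/4) t x`. Any rate above the
  -- `1/2` of the threshold `x/2` would do.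
  refine ⟨x / (2 * (y + 1)), by positivity, ?_⟩
  set t := x / (2 * (y + 1)) with ht
  have ht0 : 0 < t := by positivity
  have hpt : ∀ e, Real.exp (-t * X e) ≤ 1 - t * X e + t ^ 2 / 2 * X e ^ 2 := by
    intro e
    have hu : 0 ≤ t * X e := mul_nonneg ht0.le (hX0 e).le
    have h1 := Real.quadratic_le_exp_of_nonneg hu
    have h2 : Real.exp (-t * X e) * Real.exp (t * X e) = 1 := by
      rw [← Real.exp_add]; simp
    set u := t * X e with hudef
    have h3 : t ^ 2 / 2 * X e ^ 2 = u ^ 2 / 2 := by rw [hudef]; ring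
    rw [h3]
    have hE := Real.exp_pos (-t * X e)
    -- The product equals `1 + u⁴/4`; dividing by `eᵘ ≥ 1 + u + u²/2` yields `e⁻ᵘ ≤ 1 - u + u²/2`.
    have h4 : 1 ≤ (1 - u + u ^ 2 / 2) * (1 + u + u ^ 2 / 2) := by nlinarith [sq_nonneg (u ^ 2)]
    have h5 : 0 ≤ 1 - u + u ^ 2 / 2 := by nlinarith [sq_nonneg (u - 1)]
    have h6 : 1 ≤ (1 - u + u ^ 2 / 2) * Real.exp u :=
      h4.trans (mul_le_mul_of_nonneg_left h1 h5)
    have h7 := Real.exp_pos u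
    by_contra hcon
    push Not at hcon
    nlinarith
  have hXi : Integrable X Q := hX2.integrable (by norm_num)
  have hi1 : Integrable (fun e => 1 - t * X e) Q := (integrable_const 1).sub (hXi.const_mul t)
  have hi2 : Integrable (fun e => t ^ 2 / 2 * X e ^ 2) Q := hX2.integrable_sq.const_mul _
  have hi : Integrable (fun e => 1 - t * X e + t ^ 2 / 2 * X e ^ 2) Q := hi1.add hi2
  calc ∫⁻ e, ENNReal.ofReal (Real.exp (-t * X e)) ∂Q
      ≤ ∫⁻ e, ENNReal.ofReal (1 - t * X e + t ^ 2 / 2 * X e ^ 2) ∂Q :=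
        lintegral_mono fun e => ENNReal.ofReal_le_ofReal (hpt e)
    _ = ENNReal.ofReal (∫ e, 1 - t * X e + t ^ 2 / 2 * X e ^ 2 ∂Q) :=
        (ofReal_integral_eq_lintegral_ofReal hi (Eventually.of_forall fun e =>
          (Real.exp_pos _).le.trans (hpt e))).symm
    _ = ENNReal.ofReal (1 - t * x + t ^ 2 / 2 * y) := by
        rw [integral_add hi1 hi2, integral_sub (integrable_const 1) (hXi.const_mul t),
          integral_const_mul, integral_const_mul]
        simp [x, y]
    _ ≤ _ := by
        refine ENNReal.ofReal_le_ofReal (le_trans ?_ (Real.add_one_le_exp _))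
        have h1 : t * y ≤ x / 2 := by
          rw [ht, div_mul_eq_mul_div, div_le_div_iff₀ (by positivity) (by norm_num)]
          nlinarith
        nlinarith

namespace IsIID

variable {Ω E : Type*} [MeasurableSpace Ω] [mE : MeasurableSpace E] {ε : ℕ → Ω → E}
  {Q : Measure E} {P : Measure Ω}

/-- The contribution of the event that the empirical mean of `X` is small. -/
lemma lintegral_sq_mul_inv_pow_four_le [IsProbabilityMeasure P] (hε : IsIID ε Q P)
    {X Y : E → ℝ} (hX : Measurable X) (hX0 : ∀ e, 0 < X e) (hY : Measurable Y) {n : ℕ}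
    (hn : 1 ≤ n) {t x : ℝ} (ht : 0 < t) {N : ℕ} (hN : 1 + 4 * n ≤ N) :
    ∫⁻ ω, ENNReal.ofReal (Y (ε 0 ω) ^ 2 *
      (if (∑ l ∈ Finset.range N, X (ε l ω)) / N < x / 2
        then ((∑ l ∈ Finset.range N, X (ε l ω)) / N)⁻¹ ^ 4 else 0)) ∂P ≤
    ENNReal.ofReal (N ^ 4 * Real.exp (t * (N * x / 2))) *
      (((∫⁻ e, ENNReal.ofReal (Y e ^ 2) ∂Q) *
        (∫⁻ ω, ENNReal.ofReal (∑ l ∈ Finset.range n, X (ε l ω))⁻¹ ∂P) ^ 4) *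
        (∫⁻ e, ENNReal.ofReal (Real.exp (-t * X e)) ∂Q) ^ (N - (1 + 4 * n))) := by
  have hH1 : Measurable (fun s : ℝ => ENNReal.ofReal s⁻¹) := by fun_prop
  have hH2 : Measurable (fun s : ℝ => ENNReal.ofReal (Real.exp (-t * s))) := by fun_prop
  have hF : Measurable[⨆ j ∈ Set.Iio 1, mE.comap (ε j)]
      (fun ω => ENNReal.ofReal (Y (ε 0 ω) ^ 2)) :=
    measurable_iSup_comap (f := fun e => ENNReal.ofReal (Y e ^ 2)) (by simp) (by fun_prop)
  -- The indices are distributed as follows: `0` carries `Y²`, the next `4 n` form the blocks that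
  -- absorb the inverse powers, and the remaining `N - (1 + 4 n)` carry the exponential factor.
  obtain ⟨hF1, hI1⟩ := hε.lintegral_mul_prod_blocks hF n 4 hX hH1
  obtain ⟨hF2, hI2⟩ := hε.lintegral_mul_prod_blocks hF1 1 (N - (1 + 4 * n)) hX hH2
  have hc : ∫⁻ ω, ENNReal.ofReal (Real.exp (-t * ∑ l ∈ Finset.range 1, X (ε l ω))) ∂P =
      ∫⁻ e, ENNReal.ofReal (Real.exp (-t * X e)) ∂Q := by
    simp only [Finset.sum_range_one]
    exact hε.lintegral_comp 0 (f := fun e => ENNReal.ofReal (Real.exp (-t * X e))) (by fun_prop)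
  have hY0 : ∫⁻ ω, ENNReal.ofReal (Y (ε 0 ω) ^ 2) ∂P = ∫⁻ e, ENNReal.ofReal (Y e ^ 2) ∂Q :=
    hε.lintegral_comp 0 (f := fun e => ENNReal.ofReal (Y e ^ 2)) (by fun_prop)
  rw [hI1, hc, hY0] at hI2
  rw [← hI2, ← lintegral_const_mul _ (hF2.mono (hε.iSup_comap_le _) le_rfl)]
  refine lintegral_mono fun ω => ?_
  simp only [Finset.sum_range_one, mul_one, add_zero]
  have hN0 : (0 : ℝ) < N := by
    have : 0 < N := by omega
    exact_mod_cast this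
  have hXp : ∀ l, 0 < X (ε l ω) := fun l => hX0 _
  set s := ∑ l ∈ Finset.range N, X (ε l ω) with hs
  have hspos : 0 < s := Finset.sum_pos (fun l _ => hXp l) ⟨0, Finset.mem_range.2 (by omega)⟩
  set T : ℕ → ℝ := fun k => ∑ l ∈ Finset.range n, X (ε (1 + k * n + l) ω) with hT
  set W : ℝ := ∑ l ∈ Finset.range (N - (1 + 4 * n)), X (ε (1 + 4 * n + l) ω) with hW
  have hWs : W ≤ s := by
    have : s = ∑ l ∈ Finset.range (1 + 4 * n + (N - (1 + 4 * n))), X (ε l ω) := by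
      rw [hs]; congr 2; omega
    rw [this, Finset.sum_range_add]
    have : 0 ≤ ∑ l ∈ Finset.range (1 + 4 * n), X (ε l ω) :=
      Finset.sum_nonneg fun l _ => (hXp l).le
    linarith
  have hTpos : ∀ k, 0 < T k := fun k =>
    Finset.sum_pos (fun l _ => hXp _) ⟨0, Finset.mem_range.2 (by omega)⟩
  have hTs : ∀ k < 4, T k ≤ s := by
    intro k hk
    have h1 : T k = ∑ l ∈ Finset.Ico (1 + k * n) (1 + k * n + n), X (ε l ω) := by
      rw [Finset.sum_Ico_eq_sum_range]; simp [hT]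
    rw [h1, hs]
    refine Finset.sum_le_sum_of_subset_of_nonneg (fun l hl => ?_) fun l _ _ => (hXp l).le
    have h2 := (Finset.mem_Ico.1 hl).2
    have h3 : k * n ≤ 3 * n := Nat.mul_le_mul_right n (by omega)
    exact Finset.mem_range.2 (by omega)
  have hrhs : ENNReal.ofReal (N ^ 4 * Real.exp (t * (N * x / 2))) *
      ((ENNReal.ofReal (Y (ε 0 ω) ^ 2) * ∏ k ∈ Finset.range 4, ENNReal.ofReal (T k)⁻¹) *
        ∏ l ∈ Finset.range (N - (1 + 4 * n)),
          ENNReal.ofReal (Real.exp (-t * X (ε (1 + 4 * n + l) ω)))) =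
      ENNReal.ofReal ((N ^ 4 * Real.exp (t * (N * x / 2))) *
        ((Y (ε 0 ω) ^ 2 * ∏ k ∈ Finset.range 4, (T k)⁻¹) * Real.exp (-t * W))) := by
    have hp : 0 ≤ ∏ k ∈ Finset.range 4, (T k)⁻¹ :=
      Finset.prod_nonneg fun k _ => (inv_pos.2 (hTpos k)).le
    rw [← ENNReal.ofReal_prod_of_nonneg fun k _ => (inv_pos.2 (hTpos k)).le,
      ← ENNReal.ofReal_prod_of_nonneg fun k _ => (Real.exp_pos _).le,
      ← Real.exp_sum, ← Finset.mul_sum, ← ENNReal.ofReal_mul (sq_nonneg _),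
      ← ENNReal.ofReal_mul (by positivity), ← ENNReal.ofReal_mul (by positivity)]
  refine le_of_le_of_eq (ENNReal.ofReal_le_ofReal ?_) hrhs.symm
  -- By positivity each block sum is at most the full sum `s`, so each inverse block sum dominates
  -- `s⁻¹`.
  have hprod : (s⁻¹) ^ 4 ≤ ∏ k ∈ Finset.range 4, (T k)⁻¹ := by
    have : (s⁻¹) ^ 4 = ∏ _k ∈ Finset.range 4, s⁻¹ := by simp
    rw [this]
    refine Finset.prod_le_prod (fun k _ => by positivity) fun k hk => ?_
    exact inv_anti₀ (hTpos k) (hTs k (Finset.mem_range.1 hk))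
  have hp0 : 0 ≤ ∏ k ∈ Finset.range 4, (T k)⁻¹ := le_trans (by positivity) hprod
  split_ifs with hlt
  -- Chernoff: on the event `s < N x/2`, and `W ≤ s`, so the exponential factor can be inserted for
  -- free.
  · have hexp : 1 ≤ Real.exp (t * (N * x / 2)) * Real.exp (-t * W) := by
      rw [← Real.exp_add]
      refine Real.one_le_exp ?_
      have h1 : s < N * x / 2 := by
        rw [div_lt_iff₀ hN0] at hlt
        linarith
      nlinarith
    have h4 : (s / N)⁻¹ ^ 4 = N ^ 4 * (s⁻¹) ^ 4 := by
      rw [inv_div, div_eq_mul_inv, mul_pow]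
    calc Y (ε 0 ω) ^ 2 * (s / N)⁻¹ ^ 4
        ≤ Y (ε 0 ω) ^ 2 * (N ^ 4 * ∏ k ∈ Finset.range 4, (T k)⁻¹) := by
          rw [h4]; gcongr
      _ = (Y (ε 0 ω) ^ 2 * (N ^ 4 * ∏ k ∈ Finset.range 4, (T k)⁻¹)) * 1 := (mul_one _).symm
      _ ≤ (Y (ε 0 ω) ^ 2 * (N ^ 4 * ∏ k ∈ Finset.range 4, (T k)⁻¹)) *
            (Real.exp (t * (N * x / 2)) * Real.exp (-t * W)) := by gcongr
      _ = _ := by ring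
  · rw [mul_zero]
    positivity

/-- The event that the empirical mean of `X` is small is negligible, even when weighted with the
fourth inverse power of this mean. -/
theorem tendsto_lintegral_sq_mul_inv_pow_four [IsProbabilityMeasure P] [IsProbabilityMeasure Q]
    (hε : IsIID ε Q P)
    {X Y : E → ℝ} (hX : Measurable X) (hX0 : ∀ e, 0 < X e) (hX2 : MemLp X 2 Q)
    (hY : Measurable Y) (hY2 : MemLp Y 2 Q) {n : ℕ} (hn : 1 ≤ n)
    (hneg : ∫⁻ ω, ENNReal.ofReal (∑ l ∈ Finset.range n, X (ε l ω))⁻¹ ∂P ≠ ⊤) :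
    Tendsto (fun N : ℕ => ∫⁻ ω, ENNReal.ofReal (((∑ i ∈ Finset.range N, Y (ε i ω)) / √N) ^ 2 *
      (if (∑ l ∈ Finset.range N, X (ε l ω)) / N < (∫ e, X e ∂Q) / 2
        then ((∑ l ∈ Finset.range N, X (ε l ω)) / N)⁻¹ ^ 4 else 0)) ∂P) atTop (𝓝 0) := by
  set x := ∫ e, X e ∂Q with hxdef
  have hx : 0 < x := by
    rw [hxdef, integral_pos_iff_support_of_nonneg (fun e => (hX0 e).le)
      (hX2.integrable (by norm_num))]
    have : Function.support X = Set.univ := Set.eq_univ_of_forall fun e => (hX0 e).ne'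
    simp [this]
  obtain ⟨t, ht, hexp⟩ := exists_integral_exp_neg_le hX0 hX2 hx
  set c := ∫⁻ ω, ENNReal.ofReal (∑ l ∈ Finset.range n, X (ε l ω))⁻¹ ∂P
  set cY := ∫⁻ e, ENNReal.ofReal (Y e ^ 2) ∂Q
  have hcY : cY ≠ ⊤ := by
    have := eLpNorm_two_sq_of_memLp hY2
    rw [eLpNorm_two_sq] at this
    simp [cY, this]
  -- The net rate is `3/4 - 1/2 = 1/4`; `L` below compensates for the `1 + 4 n` variables left out
  -- of the exponential factor.
  set q : ℝ := Real.exp (-(t * x / 4)) with hq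
  have hq1 : q < 1 := Real.exp_lt_one_iff.2 (by have := mul_pos ht hx; linarith)
  set L : ℝ := Real.exp (3 / 4 * t * x * (1 + 4 * n)) with hL
  have hbound : ∀ᶠ N : ℕ in atTop,
      ∫⁻ ω, ENNReal.ofReal (((∑ i ∈ Finset.range N, Y (ε i ω)) / √N) ^ 2 *
      (if (∑ l ∈ Finset.range N, X (ε l ω)) / N < x / 2
        then ((∑ l ∈ Finset.range N, X (ε l ω)) / N)⁻¹ ^ 4 else 0)) ∂P ≤
      ENNReal.ofReal (L * (N ^ 5 * q ^ N)) * (cY * c ^ 4) := by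
    filter_upwards [eventually_ge_atTop (1 + 4 * n)] with N hN
    have hN0 : (0 : ℝ) < N := by
      have : 0 < N := by omega
      exact_mod_cast this
    set ψ : ℝ → ℝ := fun s => if s / N < x / 2 then (s / N)⁻¹ ^ 4 else 0 with hψ
    have hψ0 : ∀ s, 0 ≤ ψ s := by
      intro s
      simp only [hψ]
      split_ifs <;> positivity
    have hψm : Measurable ψ :=
      Measurable.ite (measurableSet_lt (by fun_prop) (by fun_prop)) (by fun_prop) (by fun_prop)
    have hterm : ∀ j ∈ Finset.range N,
        ∫⁻ ω, ENNReal.ofReal (Y (ε j ω) ^ 2 * ψ (∑ l ∈ Finset.range N, X (ε l ω))) ∂P ≤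
        ENNReal.ofReal (N ^ 4 * Real.exp (t * (N * x / 2))) *
        ((cY * c ^ 4) *
          (∫⁻ e, ENNReal.ofReal (Real.exp (-t * X e)) ∂Q) ^ (N - (1 + 4 * n))) := by
      intro j hj
      -- Exchanging the indices `0` and `j` preserves the full sum and the i.i.d. property, so every
      -- term `Y (ε j)` is treated like that of index `0`.
      have hinj := (Equiv.swap 0 j).injective
      have h1 := (hε.precomp hinj).lintegral_sq_mul_inv_pow_four_le hX hX0 hY hn (x := x) ht hN
      have h2 := hε.lintegral_sum_comp n hinj hX
        (H := fun s => ENNReal.ofReal s⁻¹) (by fun_prop)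
      rw [h2] at h1
      refine le_trans (le_of_eq (lintegral_congr fun ω => ?_)) h1
      have h3 : ∑ l ∈ Finset.range N, X (ε (Equiv.swap 0 j l) ω) =
          ∑ l ∈ Finset.range N, X (ε l ω) := by
        refine Equiv.Perm.sum_comp (Equiv.swap 0 j) (Finset.range N) (fun l => X (ε l ω)) ?_
        intro l hl
        have hj' := Finset.mem_range.1 hj
        rcases Equiv.swap_apply_ne_self_iff.1 hl with ⟨-, rfl | rfl⟩ <;>
          simp only [Finset.coe_range, Set.mem_Iio] <;> omega
      simp only [h3, Equiv.swap_apply_left, hψ]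
    have hexpN : (∫⁻ e, ENNReal.ofReal (Real.exp (-t * X e)) ∂Q) ^ (N - (1 + 4 * n)) ≤
        ENNReal.ofReal (Real.exp (-(3 / 4 * t * x)) ^ (N - (1 + 4 * n))) := by
      rw [ENNReal.ofReal_pow (Real.exp_pos _).le]
      gcongr
    have hreal : (N : ℝ) * ((N ^ 4 * Real.exp (t * (N * x / 2))) *
        Real.exp (-(3 / 4 * t * x)) ^ (N - (1 + 4 * n))) = L * (N ^ 5 * q ^ N) := by
      have e1 : Real.exp (t * (N * x / 2)) * Real.exp (-(3 / 4 * t * x)) ^ (N - (1 + 4 * n))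
          = L * q ^ N := by
        rw [hL, hq, ← Real.exp_nat_mul, ← Real.exp_nat_mul, ← Real.exp_add, ← Real.exp_add,
          Nat.cast_sub hN]
        push_cast
        congr 1
        ring
      calc (N : ℝ) * ((N ^ 4 * Real.exp (t * (N * x / 2))) *
        Real.exp (-(3 / 4 * t * x)) ^ (N - (1 + 4 * n)))
          = N ^ 5 * (Real.exp (t * (N * x / 2)) *
            Real.exp (-(3 / 4 * t * x)) ^ (N - (1 + 4 * n))) := by ring
        _ = _ := by rw [e1]; ring
    calc _ ≤ ∫⁻ ω, ∑ j ∈ Finset.range N,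
          ENNReal.ofReal (Y (ε j ω) ^ 2 * ψ (∑ l ∈ Finset.range N, X (ε l ω))) ∂P := by
          refine lintegral_mono fun ω => ?_
          rw [← ENNReal.ofReal_sum_of_nonneg fun j _ => mul_nonneg (sq_nonneg _) (hψ0 _),
            ← Finset.sum_mul]
          refine ENNReal.ofReal_le_ofReal (mul_le_mul_of_nonneg_right ?_ (hψ0 _))
          -- Cauchy–Schwarz: the square of the normalized sum is at most `Σ Y²`. The loss of a
          -- factor `N` is harmless against `q ^ N`.
          rw [div_pow, Real.sq_sqrt hN0.le, div_le_iff₀ hN0, mul_comm]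
          simpa using sq_sum_le_card_mul_sum_sq (s := Finset.range N) (f := fun i => Y (ε i ω))
      _ = ∑ j ∈ Finset.range N,
          ∫⁻ ω, ENNReal.ofReal (Y (ε j ω) ^ 2 * ψ (∑ l ∈ Finset.range N, X (ε l ω))) ∂P := by
          refine lintegral_finsetSum _ fun j _ => ?_
          refine (Measurable.mul ((hY.comp (hε.meas j)).pow_const 2) (hψm.comp ?_)).ennreal_ofReal
          exact Finset.measurable_fun_sum _ fun l _ => hX.comp (hε.meas l)
      _ ≤ ∑ _j ∈ Finset.range N, _ := Finset.sum_le_sum hterm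
      _ = N * (ENNReal.ofReal (N ^ 4 * Real.exp (t * (N * x / 2))) *
        ((cY * c ^ 4) *
          (∫⁻ e, ENNReal.ofReal (Real.exp (-t * X e)) ∂Q) ^ (N - (1 + 4 * n)))) := by
          rw [Finset.sum_const, Finset.card_range, nsmul_eq_mul]
      _ ≤ N * (ENNReal.ofReal (N ^ 4 * Real.exp (t * (N * x / 2))) *
        ((cY * c ^ 4) * ENNReal.ofReal (Real.exp (-(3 / 4 * t * x)) ^ (N - (1 + 4 * n))))) := by
          gcongr
      _ = ENNReal.ofReal (L * (N ^ 5 * q ^ N)) * (cY * c ^ 4) := by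
          rw [← hreal, ENNReal.ofReal_mul hN0.le, ENNReal.ofReal_mul (p := _ * _) (by positivity),
            ENNReal.ofReal_natCast]
          ring
  have hlim : Tendsto (fun N : ℕ => ENNReal.ofReal (L * (N ^ 5 * q ^ N)) * (cY * c ^ 4))
      atTop (𝓝 0) := by
    have h1 : Tendsto (fun N : ℕ => L * ((N : ℝ) ^ 5 * q ^ N)) atTop (𝓝 0) := by
      simpa using (tendsto_pow_const_mul_const_pow_of_lt_one 5 (Real.exp_pos _).le hq1).const_mul L
    have h2 := ENNReal.tendsto_ofReal h1
    rw [ENNReal.ofReal_zero] at h2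
    have h3 : cY * c ^ 4 ≠ ⊤ := ENNReal.mul_ne_top hcY (ENNReal.pow_ne_top hneg)
    simpa using ENNReal.Tendsto.mul_const h2 (Or.inr h3)
  exact tendsto_of_tendsto_of_tendsto_of_le_of_le' tendsto_const_nhds hlim
    (Eventually.of_forall fun _ => zero_le) hbound

end IsIID
end VarInf

/-! ### Remainders that vanish in mean square, and asymptotically linear sequences -/

namespace VarInf

lemma tendsto_eLpNorm_two_of_lintegral {Ω : Type*} [MeasurableSpace Ω] {μ : Measure Ω}
    {f : ℕ → Ω → ℝ} (h : Tendsto (fun N => ∫⁻ ω, ENNReal.ofReal (f N ω ^ 2) ∂μ) atTop (𝓝 0)) :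
    Tendsto (fun N => eLpNorm (f N) 2 μ) atTop (𝓝 0) := by
  have h1 := (ENNReal.continuous_rpow_const (y := (1 / 2 : ℝ))).tendsto 0 |>.comp h
  rw [ENNReal.zero_rpow_of_pos (by norm_num)] at h1
  refine h1.congr fun N => ?_
  simp only [Function.comp_apply]
  rw [← eLpNorm_two_sq, ← ENNReal.rpow_natCast, ← ENNReal.rpow_mul]
  norm_num

namespace IsIID

variable {Ω E : Type*} [MeasurableSpace Ω] [mE : MeasurableSpace E] {ε : ℕ → Ω → E}
  {Q : Measure E} {P : Measure Ω}

lemma measurable_sum (hε : IsIID ε Q P) {f : E → ℝ} (hf : Measurable f) (N : ℕ) :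
    Measurable (fun ω => ∑ i ∈ Finset.range N, f (ε i ω)) :=
  Finset.measurable_fun_sum _ fun i _ => hf.comp (hε.meas i)

lemma memLp_sum_div (hε : IsIID ε Q P) {f : E → ℝ} (hf : MemLp f 2 Q) (N : ℕ) (c : ℝ) :
    MemLp (fun ω => (∑ i ∈ Finset.range N, f (ε i ω)) / c) 2 P := by
  simp only [div_eq_mul_inv]
  exact (memLp_finsetSum _ fun i _ => hε.memLp_comp i hf).mul_const _

variable [IsProbabilityMeasure P]

/-- Mean square convergence of the empirical mean. -/
lemma tendsto_integral_sub_sq [IsProbabilityMeasure Q] (hε : IsIID ε Q P) {X : E → ℝ} (hX : Measurable X)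
    (hX2 : MemLp X 2 Q) :
    Tendsto (fun N : ℕ => ∫ ω, ((∑ l ∈ Finset.range N, X (ε l ω)) / N - ∫ e, X e ∂Q) ^ 2 ∂P)
      atTop (𝓝 0) := by
  set x := ∫ e, X e ∂Q with hx
  have hL : MemLp (fun e => X e - x) 2 Q := hX2.sub (memLp_const x)
  have h0 : ∫ e, X e - x ∂Q = 0 := by
    rw [integral_sub (hX2.integrable (by norm_num)) (integrable_const x)]
    simp [hx]
  have hlim : Tendsto (fun N : ℕ => (∫ e, (X e - x) ^ 2 ∂Q) / (N : ℝ)) atTop (𝓝 0) :=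
    tendsto_const_div_atTop_nhds_zero_nat _
  refine hlim.congr' ?_
  filter_upwards [eventually_ge_atTop 1] with N hN
  have hN0 : (N : ℝ) ≠ 0 := by
    have : N ≠ 0 := by omega
    exact_mod_cast this
  have h1 := hε.integral_sum_sq (hX.sub_const x) hL h0 (Finset.range N)
  have h2 : ∀ ω, ((∑ l ∈ Finset.range N, X (ε l ω)) / N - x) ^ 2 =
      (∑ l ∈ Finset.range N, (X (ε l ω) - x)) ^ 2 / N ^ 2 := by
    intro ω
    rw [Finset.sum_sub_distrib, ← div_pow]
    simp only [Finset.sum_const, Finset.card_range, nsmul_eq_mul]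
    rw [sub_div, mul_div_cancel_left₀ _ hN0]
  simp only [h2]
  rw [integral_div, h1, Finset.card_range]
  field_simp

/-- A normalized sum of centred variables, multiplied by a function of the empirical mean of `X`
that vanishes at the mean of `X`, is negligible in mean square. -/
theorem tendsto_eLpNorm_sum_mul [IsProbabilityMeasure Q] (hε : IsIID ε Q P)
    {X Y : E → ℝ} (hX : Measurable X) (hX0 : ∀ e, 0 < X e) (hX2 : MemLp X 2 Q)
    (hY : Measurable Y) (hY2 : MemLp Y 2 Q) (hY0 : ∫ e, Y e ∂Q = 0) {n : ℕ} (hn : 1 ≤ n)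
    (hneg : ∫⁻ ω, ENNReal.ofReal (∑ l ∈ Finset.range n, X (ε l ω))⁻¹ ∂P ≠ ⊤)
    {ψ : ℝ → ℝ} (hψ : Measurable ψ) {C : ℝ}
    (hψ1 : ∀ s, (∫ e, X e ∂Q) / 2 ≤ s → |ψ s| ≤ C)
    (hψ2 : ∀ s, (∫ e, X e ∂Q) / 2 ≤ s → |ψ s| ≤ C * |s - ∫ e, X e ∂Q|)
    (hψ3 : ∀ s, 0 < s → s < (∫ e, X e ∂Q) / 2 → |ψ s| ≤ C * s⁻¹ ^ 2) :
    Tendsto (fun N : ℕ => eLpNorm (fun ω => (∑ i ∈ Finset.range N, Y (ε i ω)) / √N *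
      ψ ((∑ l ∈ Finset.range N, X (ε l ω)) / N)) 2 P) atTop (𝓝 0) := by
  set x := ∫ e, X e ∂Q with hx
  set S : ℕ → Ω → ℝ := fun N ω => (∑ l ∈ Finset.range N, X (ε l ω)) / N with hS
  have hSm : ∀ N, Measurable (S N) := fun N => (hε.measurable_sum hX N).div_const _
  -- Cutting off the event `S N < x/2` makes the weight bounded; that event is handled by the lower
  -- tail estimate `hB`.
  set g : ℕ → Ω → ℝ := fun N ω => if S N ω < x / 2 then 0 else ψ (S N ω) ^ 2 with hg
  have hgm : ∀ N, Measurable (g N) := fun N =>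
    Measurable.ite (measurableSet_lt (hSm N) measurable_const) measurable_const
      ((hψ.comp (hSm N)).pow_const 2)
  have hg0 : ∀ N ω, 0 ≤ g N ω := by
    intro N ω; simp only [hg]; split_ifs <;> positivity
  have hgC : ∀ N ω, g N ω ≤ C ^ 2 := by
    intro N ω
    simp only [hg]
    split_ifs with h
    · positivity
    · rw [← sq_abs]
      exact pow_le_pow_left₀ (abs_nonneg _) (hψ1 _ (not_lt.1 h)) 2
  have hgle : ∀ N ω, g N ω ≤ C ^ 2 * (S N ω - x) ^ 2 := by
    intro N ω
    simp only [hg]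
    split_ifs with h
    · positivity
    · rw [← sq_abs, ← sq_abs (S N ω - x), ← mul_pow]
      exact pow_le_pow_left₀ (abs_nonneg _) (hψ2 _ (not_lt.1 h)) 2
  have hglim : Tendsto (fun N => ∫ ω, g N ω ∂P) atTop (𝓝 0) := by
    have h1 : Tendsto (fun N => ∫ ω, C ^ 2 * (S N ω - x) ^ 2 ∂P) atTop (𝓝 0) := by
      simp only [integral_const_mul]
      simpa using (hε.tendsto_integral_sub_sq hX hX2).const_mul (C ^ 2)
    refine tendsto_of_tendsto_of_tendsto_of_le_of_le tendsto_const_nhds h1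
      (fun N => integral_nonneg (hg0 N)) (fun N => ?_)
    refine integral_mono_of_nonneg (Eventually.of_forall (hg0 N)) ?_
      (Eventually.of_forall (hgle N))
    exact (((hε.memLp_sum_div hX2 N N).sub (memLp_const x)).integrable_sq).const_mul _
  have hA := hε.tendsto_integral_sq_mul hY hY2 hY0 hgm hg0 hgC hglim
  have hB := hε.tendsto_lintegral_sq_mul_inv_pow_four hX hX0 hX2 hY hY2 hn hneg
  refine tendsto_eLpNorm_two_of_lintegral ?_
  have hA' := ENNReal.tendsto_ofReal hA
  have hB' := ENNReal.Tendsto.const_mul (a := ENNReal.ofReal (C ^ 2)) hB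
    (Or.inr ENNReal.ofReal_ne_top)
  have hsum := hA'.add hB'
  rw [ENNReal.ofReal_zero, mul_zero, add_zero] at hsum
  refine tendsto_of_tendsto_of_tendsto_of_le_of_le' tendsto_const_nhds hsum
    (Eventually.of_forall fun _ => zero_le) ?_
  filter_upwards [eventually_ge_atTop 1] with N hN
  have hN0 : (0 : ℝ) < N := by exact_mod_cast hN
  have hint : Integrable (fun ω => ((∑ i ∈ Finset.range N, Y (ε i ω)) / √N) ^ 2 * g N ω) P := by
    refine ((hε.memLp_sum_div hY2 N √N).integrable_sq).mul_bdd (c := C ^ 2)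
      (hgm N).aestronglyMeasurable (Eventually.of_forall fun ω => ?_)
    rw [Real.norm_of_nonneg (hg0 N ω)]
    exact hgC N ω
  have hmm : Measurable (fun ω => ENNReal.ofReal
      (((∑ i ∈ Finset.range N, Y (ε i ω)) / √N) ^ 2 * g N ω)) :=
    ((((hε.measurable_sum hY N).div_const _).pow_const 2).mul (hgm N)).ennreal_ofReal
  rw [ofReal_integral_eq_lintegral_ofReal hint
    (Eventually.of_forall fun ω => mul_nonneg (sq_nonneg _) (hg0 N ω)),
    ← lintegral_const_mul' _ _ ENNReal.ofReal_ne_top,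
    ← lintegral_add_left hmm]
  refine lintegral_mono fun ω => ?_
  have hT0 : 0 ≤ (if S N ω < x / 2 then (S N ω)⁻¹ ^ 4 else 0) := by split_ifs <;> positivity
  rw [← ENNReal.ofReal_mul (sq_nonneg C), ← ENNReal.ofReal_add
    (mul_nonneg (sq_nonneg _) (hg0 N ω)) (by positivity)]
  refine ENNReal.ofReal_le_ofReal ?_
  have hSpos : 0 < S N ω :=
    div_pos (Finset.sum_pos (fun l _ => hX0 _) ⟨0, Finset.mem_range.2 (by omega)⟩) hN0
  change ((∑ i ∈ Finset.range N, Y (ε i ω)) / √N * ψ (S N ω)) ^ 2 ≤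
    ((∑ i ∈ Finset.range N, Y (ε i ω)) / √N) ^ 2 * g N ω + C ^ 2 *
      (((∑ i ∈ Finset.range N, Y (ε i ω)) / √N) ^ 2 *
        (if S N ω < x / 2 then (S N ω)⁻¹ ^ 4 else 0))
  simp only [hg]
  rw [mul_pow]
  split_ifs with h
  · have h1 : ψ (S N ω) ^ 2 ≤ C ^ 2 * (S N ω)⁻¹ ^ 4 := by
      have h2 := pow_le_pow_left₀ (abs_nonneg _) (hψ3 _ hSpos h) 2
      rw [sq_abs, mul_pow, ← pow_mul] at h2
      exact h2
    have := mul_le_mul_of_nonneg_left h1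
      (sq_nonneg ((∑ i ∈ Finset.range N, Y (ε i ω)) / √N))
    linarith
  · simp

/-- The second order term of the estimator is negligible in mean square. -/
theorem tendsto_eLpNorm_sum_div_mul_inv_sq [IsProbabilityMeasure Q] (hε : IsIID ε Q P)
    {X Y : E → ℝ} (hX : Measurable X) (hX0 : ∀ e, 0 < X e) (hX2 : MemLp X 2 Q)
    (hx : 0 < ∫ e, X e ∂Q)
    (hY : Measurable Y) (hY2 : MemLp Y 2 Q) {n : ℕ} (hn : 1 ≤ n)
    (hneg : ∫⁻ ω, ENNReal.ofReal (∑ l ∈ Finset.range n, X (ε l ω))⁻¹ ∂P ≠ ⊤) :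
    Tendsto (fun N : ℕ => eLpNorm (fun ω => (∑ i ∈ Finset.range N, Y (ε i ω)) / √N / N *
      ((∑ l ∈ Finset.range N, X (ε l ω)) / N)⁻¹ ^ 2) 2 P) atTop (𝓝 0) := by
  set x := ∫ e, X e ∂Q with hxdef
  set S : ℕ → Ω → ℝ := fun N ω => (∑ l ∈ Finset.range N, X (ε l ω)) / N with hS
  have hB := hε.tendsto_lintegral_sq_mul_inv_pow_four hX hX0 hX2 hY hY2 hn hneg
  refine tendsto_eLpNorm_two_of_lintegral ?_
  set y := ∫ e, Y e ^ 2 ∂Q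
  -- Where `S N ≥ x/2` the inverse square of `S N` is at most `(2/x)²`, and Cauchy–Schwarz on the
  -- sum leaves a second moment of order `1/N`.
  have hA : Tendsto (fun N : ℕ => ENNReal.ofReal ((2 / x) ^ 4 * (y / N))) atTop (𝓝 0) := by
    have h1 : Tendsto (fun N : ℕ => (2 / x) ^ 4 * (y / (N : ℝ))) atTop (𝓝 0) := by
      simpa using (tendsto_const_div_atTop_nhds_zero_nat y).const_mul ((2 / x) ^ 4)
    simpa using ENNReal.tendsto_ofReal h1
  have hsum := hA.add hB
  rw [add_zero] at hsum
  refine tendsto_of_tendsto_of_tendsto_of_le_of_le' tendsto_const_nhds hsum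
    (Eventually.of_forall fun _ => zero_le) ?_
  filter_upwards [eventually_ge_atTop 1] with N hN
  have hN1 : (1 : ℝ) ≤ N := by exact_mod_cast hN
  have hN0 : (0 : ℝ) < N := by linarith
  have hint : Integrable (fun ω => (2 / x) ^ 4 * ((∑ i ∈ Finset.range N, Y (ε i ω) ^ 2) / N ^ 2))
      P := by
    refine ((integrable_finsetSum _ fun i _ => ?_).div_const _).const_mul _
    exact (hε.memLp_comp i hY2).integrable_sq
  have hval : ∫ ω, (2 / x) ^ 4 * ((∑ i ∈ Finset.range N, Y (ε i ω) ^ 2) / N ^ 2) ∂P =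
      (2 / x) ^ 4 * (y / N) := by
    rw [integral_const_mul, integral_div, integral_finsetSum _ fun i _ =>
      (hε.memLp_comp i hY2).integrable_sq]
    simp only [fun i => hε.integral_comp i (f := fun e => Y e ^ 2) (hY.pow_const 2)]
    rw [Finset.sum_const, Finset.card_range, nsmul_eq_mul]
    field_simp
    rfl
  rw [← hval, ofReal_integral_eq_lintegral_ofReal hint (Eventually.of_forall fun ω => by positivity),
    ← lintegral_add_left (by
      have := fun i => hε.meas i
      fun_prop)]
  refine lintegral_mono fun ω => ?_
  have hT0 : 0 ≤ (if S N ω < x / 2 then (S N ω)⁻¹ ^ 4 else 0) := by split_ifs <;> positivity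
  rw [← ENNReal.ofReal_add (by positivity) (mul_nonneg (sq_nonneg _) hT0)]
  refine ENNReal.ofReal_le_ofReal ?_
  set u := ∑ i ∈ Finset.range N, Y (ε i ω) with hu
  have husq : u ^ 2 ≤ N * ∑ i ∈ Finset.range N, Y (ε i ω) ^ 2 := by
    simpa using sq_sum_le_card_mul_sum_sq (s := Finset.range N) (f := fun i => Y (ε i ω))
  change (u / √N / N * (S N ω)⁻¹ ^ 2) ^ 2 ≤ _ + (u / √N) ^ 2 *
    (if S N ω < x / 2 then (S N ω)⁻¹ ^ 4 else 0)
  have e1 : (u / √N / N * (S N ω)⁻¹ ^ 2) ^ 2 = (u / √N) ^ 2 / N ^ 2 * (S N ω)⁻¹ ^ 4 := by ring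
  rw [e1]
  split_ifs with h
  · have h1 : (u / √N) ^ 2 / N ^ 2 ≤ (u / √N) ^ 2 :=
      div_le_self (sq_nonneg _) (one_le_pow₀ hN1)
    have h2 : (u / √N) ^ 2 / N ^ 2 * (S N ω)⁻¹ ^ 4 ≤ (u / √N) ^ 2 * (S N ω)⁻¹ ^ 4 :=
      mul_le_mul_of_nonneg_right h1 (by positivity)
    have h3 : 0 ≤ (2 / x) ^ 4 * ((∑ i ∈ Finset.range N, Y (ε i ω) ^ 2) / (N : ℝ) ^ 2) := by
      positivity
    linarith
  · rw [mul_zero, add_zero, mul_comm]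
    have hx2 : 0 < x / 2 := by positivity
    have h1 : (S N ω)⁻¹ ≤ 2 / x := by
      rw [← inv_div]
      exact inv_anti₀ hx2 (not_lt.1 h)
    have h2 : 0 ≤ (S N ω)⁻¹ := inv_nonneg.2 (hx2.le.trans (not_lt.1 h))
    have h3 : (u / √N) ^ 2 / N ^ 2 ≤ (∑ i ∈ Finset.range N, Y (ε i ω) ^ 2) / N ^ 2 := by
      gcongr
      rw [div_pow, Real.sq_sqrt hN0.le, div_le_iff₀ hN0, mul_comm]
      exact husq
    gcongr

/-- First and second order asymptotics of an asymptotically linear sequence of estimators. -/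
theorem asymptotics_of_linear_add (hε : IsIID ε Q P) {K R : ℕ → Ω → ℝ} {κ : ℝ} {f : E → ℝ}
    (hf : Measurable f) (hf2 : MemLp f 2 Q) (hf0 : ∫ e, f e ∂Q = 0)
    (hR : ∀ N, Measurable (R N)) (hR2 : Tendsto (fun N => eLpNorm (R N) 2 P) atTop (𝓝 0))
    (hK : ∀ N : ℕ, 1 ≤ N → ∀ ω,
      √N * (K N ω - κ) = (∑ i ∈ Finset.range N, f (ε i ω)) / √N + R N ω) :
    (∀ᶠ N in atTop, MemLp (K N) 2 P) ∧ Tendsto (fun N => ∫ ω, K N ω ∂P) atTop (𝓝 κ) ∧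
      Tendsto (fun N : ℕ => N * variance (K N) P) atTop (𝓝 (∫ e, f e ^ 2 ∂Q)) := by
  set v := ∫ e, f e ^ 2 ∂Q with hv
  have hv0 : 0 ≤ v := integral_nonneg fun e => sq_nonneg _
  have hRL : ∀ᶠ N in atTop, MemLp (R N) 2 P := by
    filter_upwards [hR2.eventually (gt_mem_nhds (show (0 : ENNReal) < ⊤ by simp))] with N hN
    exact ⟨(hR N).aestronglyMeasurable, hN⟩
  set ρ : ℕ → ℝ := fun N => ∫ ω, R N ω ^ 2 ∂P with hρ
  have hρ0 : ∀ N, 0 ≤ ρ N := fun N => integral_nonneg fun ω => sq_nonneg _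
  have hρlim : Tendsto ρ atTop (𝓝 0) := by
    have h1 : Tendsto (fun N => (eLpNorm (R N) 2 P ^ 2).toReal) atTop (𝓝 0) := by
      have h2 : Tendsto (fun N => eLpNorm (R N) 2 P ^ 2) atTop (𝓝 0) := by
        simpa using ENNReal.Tendsto.pow (n := 2) hR2
      exact (ENNReal.tendsto_toReal ENNReal.zero_ne_top).comp h2
    refine h1.congr' ?_
    filter_upwards [hRL] with N hN
    rw [eLpNorm_two_sq_of_memLp hN, ENNReal.toReal_ofReal (hρ0 N)]
  set U : ℕ → Ω → ℝ := fun N ω => (∑ i ∈ Finset.range N, f (ε i ω)) / √N with hU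
  have hUL : ∀ N, MemLp (U N) 2 P := fun N => hε.memLp_sum_div hf2 N _
  have hU0 : ∀ N, ∫ ω, U N ω ∂P = 0 := by
    intro N
    simp only [hU]
    rw [integral_div, integral_finsetSum _ fun i _ =>
      (hε.memLp_comp i hf2).integrable (by norm_num)]
    simp [fun i => hε.integral_comp i hf, hf0]
  have hUv : ∀ N : ℕ, 1 ≤ N → ∫ ω, U N ω ^ 2 ∂P = v := by
    intro N hN
    have hN0 : (0 : ℝ) < N := by exact_mod_cast hN
    simp only [hU, div_pow, Real.sq_sqrt hN0.le]
    rw [integral_div, hε.integral_sum_sq hf hf2 hf0, Finset.card_range,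
      mul_div_cancel_left₀ _ hN0.ne']
  have hKeq : ∀ N : ℕ, 1 ≤ N → K N = fun ω => κ + (√N)⁻¹ * (U N ω + R N ω) := by
    intro N hN
    have hN0 : (0 : ℝ) < √N := Real.sqrt_pos.2 (by exact_mod_cast hN)
    funext ω
    rw [← hK N hN ω, inv_mul_cancel_left₀ hN0.ne']
    ring
  have hUR : ∀ᶠ N in atTop, MemLp (fun ω => U N ω + R N ω) 2 P := by
    filter_upwards [hRL] with N hN using (hUL N).add hN
  have hERsq : ∀ᶠ N in atTop, (∫ ω, R N ω ∂P) ^ 2 ≤ ρ N := by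
    filter_upwards [hRL] with N hN
    have h1 := variance_nonneg (R N) P
    rw [variance_eq_sub hN] at h1
    simpa using h1
  have hER : Tendsto (fun N => ∫ ω, R N ω ∂P) atTop (𝓝 0) := by
    have h1 : Tendsto (fun N => √(ρ N)) atTop (𝓝 0) := by
      simpa using hρlim.sqrt
    refine squeeze_zero_norm' ?_ h1
    filter_upwards [hERsq] with N hN
    exact Real.abs_le_sqrt hN
  refine ⟨?_, ?_, ?_⟩
  · filter_upwards [hUR, eventually_ge_atTop 1] with N hN hN1
    rw [hKeq N hN1]
    exact (memLp_const κ).add (hN.const_mul _)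
  · have hs : Tendsto (fun N : ℕ => (√(N : ℝ))⁻¹) atTop (𝓝 0) :=
      tendsto_inv_atTop_zero.comp (Real.tendsto_sqrt_atTop.comp tendsto_natCast_atTop_atTop)
    have h1 : Tendsto (fun N : ℕ => κ + (√(N : ℝ))⁻¹ * ∫ ω, R N ω ∂P) atTop (𝓝 κ) := by
      simpa using (hs.mul hER).const_add κ
    refine h1.congr' ?_
    filter_upwards [hRL, hUR, eventually_ge_atTop 1] with N hN hN' hN1
    rw [hKeq N hN1, integral_add (integrable_const κ)
      ((hN'.integrable (by norm_num)).const_mul _), integral_const_mul,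
      integral_add ((hUL N).integrable (by norm_num)) (hN.integrable (by norm_num)), hU0]
    simp
  -- The cross term obeys `2|U R| ≤ η U² + R²/η`. The choice `η = √ρ` balances it; adding `1/(N+1)`
  -- keeps `η` positive while preserving `ρ/η ≤ η` and `η → 0`.
  · set η : ℕ → ℝ := fun N => √(ρ N + 1 / ((N : ℝ) + 1)) with hη
    have hηpos : ∀ N, 0 < η N := fun N => Real.sqrt_pos.2 (by have := hρ0 N; positivity)
    have hηlim : Tendsto η atTop (𝓝 0) := by
      have h1 := (hρlim.add tendsto_one_div_add_atTop_nhds_zero_nat).sqrt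
      rwa [add_zero, Real.sqrt_zero] at h1
    have hη2 : ∀ N, ρ N / η N ≤ η N := by
      intro N
      rw [div_le_iff₀ (hηpos N), ← sq, hη, Real.sq_sqrt (by have := hρ0 N; positivity)]
      have : (0 : ℝ) ≤ 1 / ((N : ℝ) + 1) := by positivity
      linarith
    have hb : Tendsto (fun N => η N * v + η N + ρ N + ρ N) atTop (𝓝 0) := by
      simpa using (((hηlim.mul_const v).add hηlim).add hρlim).add hρlim
    rw [tendsto_iff_norm_sub_tendsto_zero]
    refine squeeze_zero' (Eventually.of_forall fun _ => norm_nonneg _) ?_ hb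
    filter_upwards [hRL, hUR, hERsq, eventually_ge_atTop 1] with N hN hN' hNsq hN1
    have hN0 : (0 : ℝ) < N := by exact_mod_cast hN1
    have hvarK : N * variance (K N) P = variance (fun ω => U N ω + R N ω) P := by
      rw [hKeq N hN1, variance_const_add (hN'.aestronglyMeasurable.const_mul _),
        variance_const_mul, inv_pow, Real.sq_sqrt hN0.le, mul_inv_cancel_left₀ hN0.ne']
    have hI1 : Integrable (fun ω => U N ω ^ 2) P := (hUL N).integrable_sq
    have hI2 : Integrable (fun ω => R N ω ^ 2) P := hN.integrable_sq
    have hI3 : Integrable (fun ω => U N ω * R N ω) P := (hUL N).integrable_mul hN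
    have hsqexp : ∫ ω, (U N ω + R N ω) ^ 2 ∂P = v + 2 * ∫ ω, U N ω * R N ω ∂P + ρ N := by
      have h1 : ∀ ω, (U N ω + R N ω) ^ 2 = U N ω ^ 2 + 2 * (U N ω * R N ω) + R N ω ^ 2 :=
        fun ω => by ring
      simp only [h1]
      have hI4 : Integrable (fun ω => U N ω ^ 2 + 2 * (U N ω * R N ω)) P :=
        hI1.add (hI3.const_mul 2)
      rw [integral_add hI4 hI2, integral_add hI1 (hI3.const_mul 2),
        integral_const_mul, hUv N hN1]
    have hmean : ∫ ω, U N ω + R N ω ∂P = ∫ ω, R N ω ∂P := by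
      rw [integral_add ((hUL N).integrable (by norm_num)) (hN.integrable (by norm_num)), hU0,
        zero_add]
    have hcross : |2 * ∫ ω, U N ω * R N ω ∂P| ≤ η N * v + η N := by
      have h1 : ‖∫ ω, 2 * (U N ω * R N ω) ∂P‖ ≤ ∫ ω, η N * U N ω ^ 2 + R N ω ^ 2 / η N ∂P := by
        refine norm_integral_le_of_norm_le ((hI1.const_mul _).add (hI2.div_const _))
          (Eventually.of_forall fun ω => ?_)
        have hp := hηpos N
        have e1 : 0 ≤ (η N * |U N ω| - |R N ω|) ^ 2 / η N := by positivity
        have e2 : (η N * |U N ω| - |R N ω|) ^ 2 / η N =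
            η N * |U N ω| ^ 2 + |R N ω| ^ 2 / η N - 2 * (|U N ω| * |R N ω|) := by
          field_simp
          ring
        rw [e2, sq_abs, sq_abs] at e1
        rw [Real.norm_eq_abs, abs_mul, abs_mul, abs_two]
        linarith
      rw [integral_const_mul, integral_add (hI1.const_mul _) (hI2.div_const _),
        integral_const_mul, integral_div, hUv N hN1] at h1
      exact h1.trans (by gcongr; exact hη2 N)
    rw [hvarK, variance_eq_sub hN']
    simp only [Pi.pow_apply]
    rw [hsqexp, hmean, Real.norm_eq_abs]
    have h2 := abs_le.1 hcross
    have h3 := hρ0 N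
    have h4 := sq_nonneg (∫ ω, R N ω ∂P)
    rw [abs_le]
    constructor <;> linarith [h2.1, h2.2]

end IsIID
end VarInf

/-! ### Asymptotics of a single row of the estimator -/

namespace VarInf

lemma tendsto_eLpNorm_two_add_mul {Ω : Type*} [MeasurableSpace Ω] {μ : Measure Ω}
    {F G : ℕ → Ω → ℝ} (hF : ∀ N, Measurable (F N)) (hG : ∀ N, Measurable (G N)) (c d : ℝ)
    (hF2 : Tendsto (fun N => eLpNorm (F N) 2 μ) atTop (𝓝 0))
    (hG2 : Tendsto (fun N => eLpNorm (G N) 2 μ) atTop (𝓝 0)) :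
    Tendsto (fun N => eLpNorm (fun ω => c * F N ω + d * G N ω) 2 μ) atTop (𝓝 0) := by
  have h1 := (ENNReal.Tendsto.const_mul (a := ‖c‖ₑ) hF2 (Or.inr (by simp))).add
    (ENNReal.Tendsto.const_mul (a := ‖d‖ₑ) hG2 (Or.inr (by simp)))
  rw [mul_zero, mul_zero, add_zero] at h1
  refine tendsto_of_tendsto_of_tendsto_of_le_of_le tendsto_const_nhds h1 (fun _ => zero_le)
    fun N => ?_
  refine (eLpNorm_add_le ((hF N).const_mul c).aestronglyMeasurable
    ((hG N).const_mul d).aestronglyMeasurable (by norm_num)).trans (le_of_eq ?_)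
  rw [← eLpNorm_const_smul, ← eLpNorm_const_smul]
  rfl

/-- The estimator built from `N` noise variables, in terms of `A = w^{1-α} ∂ log w`,
`B = w^{2(1-α)} ∂ log w` and `X = w^{1-α}`. -/
noncomputable def rowEstimator {E : Type*} (α : ℝ) (X A B : E → ℝ) (N : ℕ) (y : ℕ → E) : ℝ :=
  α * ((∑ j ∈ Finset.range N, A (y j)) / ∑ j ∈ Finset.range N, X (y j)) +
    (1 - α) * ((∑ j ∈ Finset.range N, B (y j)) / (∑ j ∈ Finset.range N, X (y j)) ^ 2)

namespace IsIID

variable {Ω E : Type*} [MeasurableSpace Ω] [mE : MeasurableSpace E] {ε : ℕ → Ω → E}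
  {Q : Measure E} {P : Measure Ω} [IsProbabilityMeasure P] [IsProbabilityMeasure Q]

/-- Delta method for the ratio. With `Y = A - (a/x) X` centred and `S` the empirical mean of `X`,
the error times `√N` is exactly `α (ΣY/√N) S⁻¹ + (1-α) (ΣB/√N) N⁻¹ S⁻²`. Replacing `S⁻¹` by `x⁻¹`
gives the linear part; the rest is negligible. -/
theorem rowEstimator_asymptotics (hε : IsIID ε Q P)
    {X A B : E → ℝ} (hX : Measurable X) (hX0 : ∀ e, 0 < X e) (hX2 : MemLp X 2 Q)
    (hx : 0 < ∫ e, X e ∂Q)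
    (hA : Measurable A) (hA2 : MemLp A 2 Q) (hB : Measurable B) (hB2 : MemLp B 2 Q)
    {n : ℕ} (hn : 1 ≤ n)
    (hneg : ∫⁻ ω, ENNReal.ofReal (∑ l ∈ Finset.range n, X (ε l ω))⁻¹ ∂P ≠ ⊤) (α : ℝ) :
    (∀ᶠ N in atTop, MemLp (fun ω => rowEstimator α X A B N (fun i => ε i ω)) 2 P) ∧
    Tendsto (fun N => ∫ ω, rowEstimator α X A B N (fun i => ε i ω) ∂P) atTop
      (𝓝 (α * (∫ e, A e ∂Q) / ∫ e, X e ∂Q)) ∧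
    Tendsto (fun N : ℕ => N * variance (fun ω => rowEstimator α X A B N (fun i => ε i ω)) P) atTop
      (𝓝 (α ^ 2 * variance (fun e => A e / (∫ e, X e ∂Q)
        - X e * (∫ e, A e ∂Q) / (∫ e, X e ∂Q) ^ 2) Q)) := by
  set x := ∫ e, X e ∂Q with hxdef
  set a := ∫ e, A e ∂Q with hadef
  set Y : E → ℝ := fun e => A e - a / x * X e with hY
  have hYm : Measurable Y := hA.sub (hX.const_mul _)
  have hY2 : MemLp Y 2 Q := hA2.sub (hX2.const_mul _)
  have hY0 : ∫ e, Y e ∂Q = 0 := by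
    rw [hY, integral_sub (hA2.integrable (by norm_num))
      ((hX2.integrable (by norm_num)).const_mul _), integral_const_mul, ← hxdef, ← hadef]
    field_simp
    ring
  set ψ : ℝ → ℝ := fun s => s⁻¹ - x⁻¹ with hψ
  have hψm : Measurable ψ := by fun_prop
  -- The three summands bound `|ψ|` on `s ≥ x/2`, its Lipschitz constant at `x` there, and `s² |ψ
  -- s|` for `s < x/2`.
  set C : ℝ := 3 / x + 2 / x ^ 2 + x / 2 with hC
  have hhalf : ∀ s, x / 2 ≤ s → 0 < s ∧ s⁻¹ ≤ 2 / x := by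
    intro s hs
    have hs0 : 0 < s := by linarith
    refine ⟨hs0, ?_⟩
    rw [← inv_div]
    exact inv_anti₀ (by positivity) hs
  have hlim1 := hε.tendsto_eLpNorm_sum_mul hX hX0 hX2 hYm hY2 hY0 hn hneg hψm (C := C)
    (fun s hs => by
      obtain ⟨hs0, hs1⟩ := hhalf s hs
      have h1 : |s⁻¹ - x⁻¹| ≤ s⁻¹ + x⁻¹ := by
        rw [abs_le]; constructor <;> linarith [inv_pos.2 hs0, inv_pos.2 hx]
      have h2 : s⁻¹ + x⁻¹ ≤ 3 / x := by
        have : 3 / x = 2 / x + x⁻¹ := by field_simp; norm_num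
        linarith
      have h3 : 0 ≤ 2 / x ^ 2 + x / 2 := by positivity
      simp only [hψ]
      linarith)
    (fun s hs => by
      obtain ⟨hs0, hs1⟩ := hhalf s hs
      have h1 : s⁻¹ - x⁻¹ = -(s⁻¹ * x⁻¹ * (s - x)) := by
        field_simp
        ring
      simp only [hψ]
      rw [h1, abs_neg, abs_mul]
      refine mul_le_mul_of_nonneg_right ?_ (abs_nonneg _)
      rw [abs_of_pos (by positivity)]
      have h2 : s⁻¹ * x⁻¹ ≤ 2 / x ^ 2 := by
        have : 2 / x ^ 2 = 2 / x * x⁻¹ := by field_simp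
        rw [this]
        gcongr
      have h3 : 0 ≤ 3 / x + x / 2 := by positivity
      linarith)
    (fun s hs0 hs => by
      have hs2 : s < x := by linarith
      have h1 : x⁻¹ ≤ s⁻¹ := inv_anti₀ hs0 hs2.le
      simp only [hψ]
      rw [abs_of_nonneg (by linarith)]
      have h2 : s⁻¹ = s * s⁻¹ ^ 2 := by field_simp
      have h3 : s * s⁻¹ ^ 2 ≤ x / 2 * s⁻¹ ^ 2 := by gcongr
      have h4 : 0 ≤ (3 / x + 2 / x ^ 2) * s⁻¹ ^ 2 := by positivity
      have h5 : C * s⁻¹ ^ 2 = (3 / x + 2 / x ^ 2) * s⁻¹ ^ 2 + x / 2 * s⁻¹ ^ 2 := by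
        rw [hC]; ring
      linarith [inv_pos.2 hx])
  have hlim2 := hε.tendsto_eLpNorm_sum_div_mul_inv_sq hX hX0 hX2 hx hB hB2 hn hneg
  have hSm : ∀ N : ℕ, Measurable (fun ω => (∑ l ∈ Finset.range N, X (ε l ω)) / (N : ℝ)) :=
    fun N => (hε.measurable_sum hX N).div_const _
  have hm1 : ∀ N : ℕ, Measurable (fun ω => (∑ i ∈ Finset.range N, Y (ε i ω)) / √N *
      ψ ((∑ l ∈ Finset.range N, X (ε l ω)) / N)) := fun N =>
    ((hε.measurable_sum hYm N).div_const _).mul (hψm.comp (hSm N))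
  have hm2 : ∀ N : ℕ, Measurable (fun ω => (∑ i ∈ Finset.range N, B (ε i ω)) / √N / N *
      ((∑ l ∈ Finset.range N, X (ε l ω)) / N)⁻¹ ^ 2) := fun N =>
    (((hε.measurable_sum hB N).div_const _).div_const _).mul ((hSm N).inv.pow_const 2)
  have hR := tendsto_eLpNorm_two_add_mul hm1 hm2 α (1 - α) hlim1 hlim2
  have hf : Measurable (fun e => α / x * Y e) := hYm.const_mul _
  have hmain := hε.asymptotics_of_linear_add (κ := α * a / x)
    (K := fun N ω => rowEstimator α X A B N (fun i => ε i ω)) hf (hY2.const_mul _)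
    (by rw [integral_const_mul, hY0, mul_zero])
    (fun N => ((hm1 N).const_mul α).add ((hm2 N).const_mul (1 - α))) hR (by
      intro N hN ω
      have hN0 : (0 : ℝ) < N := by exact_mod_cast hN
      have hs : 0 < ∑ l ∈ Finset.range N, X (ε l ω) :=
        Finset.sum_pos (fun l _ => hX0 _) ⟨0, Finset.mem_range.2 (by omega)⟩
      simp only [Pi.add_apply, rowEstimator, hY, hψ, Finset.sum_sub_distrib, ← Finset.mul_sum]
      set s := ∑ l ∈ Finset.range N, X (ε l ω)
      set sA := ∑ l ∈ Finset.range N, A (ε l ω)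
      set sB := ∑ l ∈ Finset.range N, B (ε l ω)
      obtain ⟨r, hr⟩ : ∃ r, r = √(N : ℝ) := ⟨_, rfl⟩
      have hr0 : 0 < r := by rw [hr]; exact Real.sqrt_pos.2 hN0
      have hN' : (N : ℝ) = r ^ 2 := by rw [hr, Real.sq_sqrt hN0.le]
      rw [← hr, hN']
      field_simp
      ring)
  refine ⟨hmain.1, hmain.2.1, ?_⟩
  have hv : α ^ 2 * variance (fun e => A e / x - X e * a / x ^ 2) Q =
      ∫ e, (α / x * Y e) ^ 2 ∂Q := by
    have h1 : ∀ e, A e / x - X e * a / x ^ 2 = x⁻¹ * Y e := by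
      intro e
      simp only [hY]
      field_simp
    simp only [h1]
    rw [variance_const_mul, variance_of_integral_eq_zero hYm.aemeasurable hY0]
    simp only [mul_pow, integral_const_mul]
    ring
  rw [hv]
  exact hmain.2.2

/-- The linear part is a first order expansion of `u/s²` at `(b, x)`. With `Y = B - (2b/x) X + b`
and `Z = X - x`, the error times `√N` is exactly `(ΣY/√N) S⁻² - (b/x²) (ΣZ/√N) (S - x) S⁻²`. `A` has
coefficient `0`, so nothing is required of it. -/
theorem rowEstimator_zero_asymptotics (hε : IsIID ε Q P)
    {X A B : E → ℝ} (hX : Measurable X) (hX0 : ∀ e, 0 < X e) (hX2 : MemLp X 2 Q)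
    (hx : 0 < ∫ e, X e ∂Q) (hB : Measurable B) (hB2 : MemLp B 2 Q)
    {n : ℕ} (hn : 1 ≤ n)
    (hneg : ∫⁻ ω, ENNReal.ofReal (∑ l ∈ Finset.range n, X (ε l ω))⁻¹ ∂P ≠ ⊤) :
    (∀ᶠ N : ℕ in atTop,
      MemLp (fun ω => (N : ℝ) * rowEstimator 0 X A B N (fun i => ε i ω)) 2 P) ∧
    Tendsto (fun N : ℕ => ∫ ω, N * rowEstimator 0 X A B N (fun i => ε i ω) ∂P) atTop
      (𝓝 ((∫ e, B e ∂Q) / (∫ e, X e ∂Q) ^ 2)) ∧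
    Tendsto (fun N : ℕ => N *
      variance (fun ω => N * rowEstimator 0 X A B N (fun i => ε i ω)) P) atTop
      (𝓝 (variance (fun e => B e / (∫ e, X e ∂Q) ^ 2
        - X e * (2 * ∫ e, B e ∂Q) / (∫ e, X e ∂Q) ^ 3) Q)) := by
  set x := ∫ e, X e ∂Q with hxdef
  set b := ∫ e, B e ∂Q with hbdef
  have hXi : Integrable X Q := hX2.integrable (by norm_num)
  have hBi : Integrable B Q := hB2.integrable (by norm_num)
  set Y : E → ℝ := fun e => B e - 2 * b / x * X e + b with hY
  have hYm : Measurable Y := (hB.sub (hX.const_mul _)).add_const b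
  have hY2 : MemLp Y 2 Q := (hB2.sub (hX2.const_mul _)).add (memLp_const b)
  have hY0 : ∫ e, Y e ∂Q = 0 := by
    have h1 : Integrable (fun e => B e - 2 * b / x * X e) Q := hBi.sub (hXi.const_mul _)
    rw [hY, integral_add h1 (integrable_const b),
      integral_sub hBi (hXi.const_mul _), integral_const_mul, ← hxdef, ← hbdef]
    simp only [integral_const, probReal_univ, smul_eq_mul, one_mul]
    field_simp
    ring
  set Z : E → ℝ := fun e => X e - x with hZ
  have hZm : Measurable Z := hX.sub_const x
  have hZ2 : MemLp Z 2 Q := hX2.sub (memLp_const x)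
  have hZ0 : ∫ e, Z e ∂Q = 0 := by
    rw [hZ, integral_sub hXi (integrable_const x)]
    simp [hxdef]
  have hhalf : ∀ s, x / 2 ≤ s → 0 < s ∧ s⁻¹ ≤ 2 / x := by
    intro s hs
    have hs0 : 0 < s := by linarith
    refine ⟨hs0, ?_⟩
    rw [← inv_div]
    exact inv_anti₀ (by positivity) hs
  set ψ : ℝ → ℝ := fun s => s⁻¹ ^ 2 - x⁻¹ ^ 2 with hψ
  have hψm : Measurable ψ := by fun_prop
  -- The quadratic remainder `(S - x)² S⁻²` is written as one centred normalized sum times `χ S`,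
  -- where `χ` vanishes at `x`; it then has the form covered by `tendsto_eLpNorm_sum_mul`.
  set χ : ℝ → ℝ := fun s => (s - x) * s⁻¹ ^ 2 with hχ
  have hχm : Measurable χ := by fun_prop
  have hlim1 := hε.tendsto_eLpNorm_sum_mul hX hX0 hX2 hYm hY2 hY0 hn hneg hψm
    (C := 5 / x ^ 2 + 6 / x ^ 3 + 1)
    (fun s hs => by
      obtain ⟨hs0, hs1⟩ := hhalf s hs
      have hp1 : 0 < s⁻¹ := inv_pos.2 hs0
      have h1 : |s⁻¹ ^ 2 - x⁻¹ ^ 2| ≤ s⁻¹ ^ 2 + x⁻¹ ^ 2 := by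
        rw [abs_le]; constructor <;> linarith [sq_nonneg s⁻¹, sq_nonneg x⁻¹]
      have h2 : s⁻¹ ^ 2 ≤ (2 / x) ^ 2 := by gcongr
      have h3 : 5 / x ^ 2 = (2 / x) ^ 2 + x⁻¹ ^ 2 := by field_simp; norm_num
      have h4 : 0 ≤ 6 / x ^ 3 := by positivity
      simp only [hψ]
      linarith)
    (fun s hs => by
      obtain ⟨hs0, hs1⟩ := hhalf s hs
      have hp1 : 0 < s⁻¹ := inv_pos.2 hs0
      have h1 : s⁻¹ ^ 2 - x⁻¹ ^ 2 = -((s⁻¹ * x⁻¹ ^ 2 + s⁻¹ ^ 2 * x⁻¹) * (s - x)) := by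
        field_simp; ring
      simp only [hψ]
      rw [h1, abs_neg, abs_mul]
      refine mul_le_mul_of_nonneg_right ?_ (abs_nonneg _)
      rw [abs_of_pos (by positivity)]
      have h2 : s⁻¹ * x⁻¹ ^ 2 + s⁻¹ ^ 2 * x⁻¹ ≤ 2 / x * x⁻¹ ^ 2 + (2 / x) ^ 2 * x⁻¹ := by gcongr
      have h3 : 6 / x ^ 3 = 2 / x * x⁻¹ ^ 2 + (2 / x) ^ 2 * x⁻¹ := by field_simp; norm_num
      have h4 : 0 ≤ 5 / x ^ 2 := by positivity
      linarith)
    (fun s hs0 hs => by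
      have hs2 : s < x := by linarith
      have h1 : x⁻¹ ^ 2 ≤ s⁻¹ ^ 2 := by
        have := inv_anti₀ hs0 hs2.le
        gcongr
      simp only [hψ]
      rw [abs_of_nonneg (by linarith)]
      have h4 : 0 ≤ (5 / x ^ 2 + 6 / x ^ 3) * s⁻¹ ^ 2 := by positivity
      linarith [sq_nonneg x⁻¹])
  have hlim2 := hε.tendsto_eLpNorm_sum_mul hX hX0 hX2 hZm hZ2 hZ0 hn hneg hχm
    (C := 6 / x + 4 / x ^ 2 + x)
    (fun s hs => by
      obtain ⟨hs0, hs1⟩ := hhalf s hs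
      have hp1 : 0 < s⁻¹ := inv_pos.2 hs0
      simp only [hχ]
      rw [abs_mul, abs_of_pos (show 0 < s⁻¹ ^ 2 by positivity)]
      have h1 : |s - x| ≤ s + x := by rw [abs_le]; constructor <;> linarith
      have h2 : (s + x) * s⁻¹ ^ 2 = s⁻¹ + x * s⁻¹ ^ 2 := by field_simp
      have h3 : s⁻¹ + x * s⁻¹ ^ 2 ≤ 2 / x + x * (2 / x) ^ 2 := by gcongr
      have h4 : 6 / x = 2 / x + x * (2 / x) ^ 2 := by field_simp; norm_num
      have h5 : |s - x| * s⁻¹ ^ 2 ≤ (s + x) * s⁻¹ ^ 2 := by gcongr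
      have h6 : 0 ≤ 4 / x ^ 2 := by positivity
      linarith)
    (fun s hs => by
      obtain ⟨hs0, hs1⟩ := hhalf s hs
      have hp1 : 0 < s⁻¹ := inv_pos.2 hs0
      simp only [hχ]
      rw [abs_mul, abs_of_pos (show 0 < s⁻¹ ^ 2 by positivity), mul_comm]
      refine mul_le_mul_of_nonneg_right ?_ (abs_nonneg _)
      have h2 : s⁻¹ ^ 2 ≤ (2 / x) ^ 2 := by gcongr
      have h3 : 4 / x ^ 2 = (2 / x) ^ 2 := by rw [div_pow]; norm_num
      have h4 : 0 ≤ 6 / x := by positivity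
      linarith)
    (fun s hs0 hs => by
      simp only [hχ]
      rw [abs_mul, abs_of_nonneg (sq_nonneg s⁻¹)]
      refine mul_le_mul_of_nonneg_right ?_ (sq_nonneg _)
      have h1 : |s - x| ≤ x := by rw [abs_le]; constructor <;> linarith
      have h4 : 0 ≤ 6 / x + 4 / x ^ 2 := by positivity
      linarith)
  have hSm : ∀ N : ℕ, Measurable (fun ω => (∑ l ∈ Finset.range N, X (ε l ω)) / (N : ℝ)) :=
    fun N => (hε.measurable_sum hX N).div_const _
  have hm1 : ∀ N : ℕ, Measurable (fun ω => (∑ i ∈ Finset.range N, Y (ε i ω)) / √N *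
      ψ ((∑ l ∈ Finset.range N, X (ε l ω)) / N)) := fun N =>
    ((hε.measurable_sum hYm N).div_const _).mul (hψm.comp (hSm N))
  have hm2 : ∀ N : ℕ, Measurable (fun ω => (∑ i ∈ Finset.range N, Z (ε i ω)) / √N *
      χ ((∑ l ∈ Finset.range N, X (ε l ω)) / N)) := fun N =>
    ((hε.measurable_sum hZm N).div_const _).mul (hχm.comp (hSm N))
  have hR := tendsto_eLpNorm_two_add_mul hm1 hm2 1 (-(b / x ^ 2)) hlim1 hlim2
  have hf : Measurable (fun e => (x ^ 2)⁻¹ * Y e) := hYm.const_mul _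
  have hmain := hε.asymptotics_of_linear_add (κ := b / x ^ 2)
    (K := fun N ω => (N : ℝ) * rowEstimator 0 X A B N (fun i => ε i ω)) hf (hY2.const_mul _)
    (by rw [integral_const_mul, hY0, mul_zero])
    (fun N => ((hm1 N).const_mul 1).add ((hm2 N).const_mul (-(b / x ^ 2)))) hR (by
      intro N hN ω
      have hN0 : (0 : ℝ) < N := by exact_mod_cast hN
      have hs : 0 < ∑ l ∈ Finset.range N, X (ε l ω) :=
        Finset.sum_pos (fun l _ => hX0 _) ⟨0, Finset.mem_range.2 (by omega)⟩
      simp only [Pi.add_apply, rowEstimator, hY, hZ, hψ, hχ, Finset.sum_sub_distrib, Finset.sum_add_distrib,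
        ← Finset.mul_sum, Finset.sum_const, Finset.card_range, nsmul_eq_mul]
      set s := ∑ l ∈ Finset.range N, X (ε l ω)
      set sB := ∑ l ∈ Finset.range N, B (ε l ω)
      obtain ⟨r, hr⟩ : ∃ r, r = √(N : ℝ) := ⟨_, rfl⟩
      have hr0 : 0 < r := by rw [hr]; exact Real.sqrt_pos.2 hN0
      have hN' : (N : ℝ) = r ^ 2 := by rw [hr, Real.sq_sqrt hN0.le]
      rw [← hr, hN']
      field_simp
      ring)
  refine ⟨hmain.1, hmain.2.1, ?_⟩
  have hv : variance (fun e => B e / x ^ 2 - X e * (2 * b) / x ^ 3) Q =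
      ∫ e, ((x ^ 2)⁻¹ * Y e) ^ 2 ∂Q := by
    -- The two variables differ by a constant, which the variance ignores.
    have h1 : ∀ e, B e / x ^ 2 - X e * (2 * b) / x ^ 3 = -(b / x ^ 2) + (x ^ 2)⁻¹ * Y e := by
      intro e
      simp only [hY]
      field_simp
      ring
    simp only [h1]
    rw [variance_const_add hf.aestronglyMeasurable, variance_of_integral_eq_zero hf.aemeasurable
      (by rw [integral_const_mul, hY0, mul_zero])]
  rw [hv]
  exact hmain.2.2

end IsIID

end VarInf

/-! ### Averages over independent rows and their signal-to-noise ratio -/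

namespace VarInf
namespace IsIID

variable {Ω E : Type*} [MeasurableSpace Ω] [mE : MeasurableSpace E] {ε : ℕ × ℕ → Ω → E}
  {Q : Measure E} {P : Measure Ω}

lemma row (hε : IsIID ε Q P) (m : ℕ) : IsIID (fun j => ε (m, j)) Q P :=
  hε.precomp (Prod.mk_right_injective m)

variable {N : ℕ} {F : (Fin N → E) → ℝ}

lemma indepFun_row (hε : IsIID ε Q P) (hF : Measurable F) {m m' : ℕ} (hm : m ≠ m') :
    IndepFun (fun ω => F (fun i => ε (m, i) ω)) (fun ω => F (fun i => ε (m', i) ω)) P := by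
  have hdisj : Disjoint ({m} ×ˢ (Set.univ : Set ℕ)) ({m'} ×ˢ (Set.univ : Set ℕ)) := by
    rw [Set.disjoint_left]
    rintro ⟨i, j⟩ h1 h2
    exact hm ((Set.mem_prod.1 h1).1.symm.trans (Set.mem_prod.1 h2).1)
  have hmeas : ∀ m, Measurable[⨆ j ∈ ({m} ×ˢ (Set.univ : Set ℕ) : Set (ℕ × ℕ)), mE.comap (ε j)]
      (fun ω => F (fun i => ε (m, i) ω)) := by
    intro m
    refine hF.comp ?_
    rw [@measurable_pi_iff]
    exact fun i => measurable_iSup_comap (f := id) (by simp) measurable_id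
  rw [IndepFun_iff_Indep]
  exact indep_of_indep_of_le_left (indep_of_indep_of_le_right
    (indep_iSup_of_disjoint (fun j => (hε.meas j).comap_le) hε.indep hdisj)
    (hmeas m').comap_le) (hmeas m).comap_le

variable [IsProbabilityMeasure P]

lemma measurePreserving_row (hε : IsIID ε Q P) (N m : ℕ) :
    MeasurePreserving (fun ω (i : Fin N) => ε (m, i) ω) P (Measure.pi fun _ => Q) :=
  ⟨measurable_pi_lambda _ fun i => hε.meas (m, i),
    hε.map_tuple (u := fun i : Fin N => (m, (i : ℕ)))
      ((Prod.mk_right_injective m).comp Fin.val_injective)⟩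

lemma memLp_row (hε : IsIID ε Q P) (hF : Measurable F)
    (hF0 : MemLp (fun ω => F (fun i => ε (0, i) ω)) 2 P) (m : ℕ) :
    MemLp (fun ω => F (fun i => ε (m, i) ω)) 2 P := by
  have h := hε.measurePreserving_row N
  have h' : MemLp F 2 (Measure.pi fun _ => Q) := by
    rw [← (h 0).map_eq]
    exact (memLp_map_measure_iff hF.aestronglyMeasurable
      (h 0).measurable.aemeasurable).2 hF0
  exact h'.comp_measurePreserving (h m)

lemma integral_row (hε : IsIID ε Q P) (hF : Measurable F) (m : ℕ) :
    ∫ ω, F (fun i => ε (m, i) ω) ∂P = ∫ y, F y ∂Measure.pi (fun _ => Q) := by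
  have h := hε.measurePreserving_row N m
  rw [← h.map_eq, integral_map h.measurable.aemeasurable hF.aestronglyMeasurable]

/-- The average over `M` independent rows has the same mean as a row, and `1 / M` times its
variance. -/
lemma average_rows (hε : IsIID ε Q P) (hF : Measurable F)
    (hF0 : MemLp (fun ω => F (fun i => ε (0, i) ω)) 2 P) {M : ℕ} (hM : 1 ≤ M) :
    MemLp (fun ω => (1 / (M : ℝ)) * ∑ m ∈ Finset.range M, F (fun i => ε (m, i) ω)) 2 P ∧
    ∫ ω, (1 / (M : ℝ)) * ∑ m ∈ Finset.range M, F (fun i => ε (m, i) ω) ∂P =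
      ∫ ω, F (fun i => ε (0, i) ω) ∂P ∧
    variance (fun ω => (1 / (M : ℝ)) * ∑ m ∈ Finset.range M, F (fun i => ε (m, i) ω)) P =
      variance (fun ω => F (fun i => ε (0, i) ω)) P / M := by
  have hM0 : (M : ℝ) ≠ 0 := by
    have : M ≠ 0 := by omega
    exact_mod_cast this
  have hL := hε.memLp_row hF hF0
  refine ⟨(memLp_finsetSum _ fun m _ => hL m).const_mul _, ?_, ?_⟩
  · rw [integral_const_mul, integral_finsetSum _ fun m _ => (hL m).integrable (by norm_num)]
    simp only [hε.integral_row hF]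
    rw [Finset.sum_const, Finset.card_range, nsmul_eq_mul]
    field_simp
  · rw [variance_const_mul]
    have h1 := IndepFun.variance_sum (s := Finset.range M)
      (X := fun m ω => F (fun i => ε (m, i) ω)) (fun m _ => hL m)
      (fun m _ m' _ hm => hε.indepFun_row hF hm)
    have h2 : ∀ m, variance (fun ω => F (fun i => ε (m, i) ω)) P =
        variance (fun ω => F (fun i => ε (0, i) ω)) P := by
      intro m
      rw [variance_eq_sub (hL m), variance_eq_sub (hL 0)]
      simp only [Pi.pow_apply]
      rw [hε.integral_row (F := fun y => F y ^ 2) (hF.pow_const 2) m,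
        hε.integral_row (F := fun y => F y ^ 2) (hF.pow_const 2) 0, hε.integral_row hF m,
        hε.integral_row hF 0]
    have h3 : (fun ω => ∑ m ∈ Finset.range M, F (fun i => ε (m, i) ω)) =
        ∑ m ∈ Finset.range M, fun ω => F (fun i => ε (m, i) ω) := by
      funext ω; simp
    rw [h3, h1]
    simp only [h2]
    rw [Finset.sum_const, Finset.card_range, nsmul_eq_mul]
    field_simp

/-- The signal-to-noise ratio of averages over `M` independent rows of length `N`, from the
asymptotics of the first two moments of a rescaled row. -/
theorem exists_snr_eq (hε : IsIID ε Q P) {F : (N : ℕ) → (Fin N → E) → ℝ}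
    (hF : ∀ N, Measurable (F N)) {c : ℕ → ℝ} (hc : ∀ N, 1 ≤ N → 0 < c N) {κ κ' v : ℝ}
    (hκ : |κ'| = |κ|)
    (hL : ∀ᶠ N in atTop, MemLp (fun ω => c N * F N (fun i => ε (0, i) ω)) 2 P)
    (hE : Tendsto (fun N => ∫ ω, c N * F N (fun i => ε (0, i) ω) ∂P) atTop (𝓝 κ))
    (hV : Tendsto (fun N : ℕ => N * variance (fun ω => c N * F N (fun i => ε (0, i) ω)) P) atTop
      (𝓝 v)) :
    ∃ r s : ℕ → ℝ, Tendsto r atTop (𝓝 0) ∧ Tendsto s atTop (𝓝 0) ∧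
      ∀ᶠ N : ℕ in atTop, 0 ≤ √v + s N ∧ ∀ M : ℕ, 1 ≤ M →
        MemLp (fun ω => (1 / (M : ℝ)) * ∑ m ∈ Finset.range M, F N (fun i => ε (m, i) ω)) 2 P ∧
        snr P (fun ω => (1 / (M : ℝ)) * ∑ m ∈ Finset.range M, F N (fun i => ε (m, i) ω)) =
          ENNReal.ofReal (√((M : ℝ) * N)) *
            (ENNReal.ofReal |κ' + r N| / ENNReal.ofReal (√v + s N)) := by
  -- The target `κ'` may be the opposite of the limit of the mean; the sign is absorbed into the
  -- error term.
  obtain ⟨σ, hσ, hσκ⟩ : ∃ σ : ℝ, |σ| = 1 ∧ κ' = σ * κ := by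
    rcases abs_eq_abs.1 hκ with h | h
    · exact ⟨1, by simp, by simp [h]⟩
    · exact ⟨-1, by simp, by simp [h]⟩
  -- Both errors are the exact deviations of one row, hence do not depend on `M`, and `√v + s N` is
  -- itself a square root.
  refine ⟨fun N => σ * (∫ ω, c N * F N (fun i => ε (0, i) ω) ∂P) - κ',
    fun N => √(N * variance (fun ω => c N * F N (fun i => ε (0, i) ω)) P) - √v, ?_, ?_, ?_⟩
  · have h1 := (hE.const_mul σ).sub_const κ'
    rwa [hσκ, sub_self, ← hσκ] at h1
  · simpa using hV.sqrt.sub_const (√v)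
  · filter_upwards [hL, eventually_ge_atTop 1] with N hN hN1
    have hN0 : (0 : ℝ) < N := by exact_mod_cast hN1
    have hcN := hc N hN1
    refine ⟨by rw [add_sub_cancel]; positivity, fun M hM => ?_⟩
    have hM0 : (0 : ℝ) < M := by exact_mod_cast hM
    have hF0 : MemLp (fun ω => F N (fun i => ε (0, i) ω)) 2 P := by
      have h1 := hN.const_mul (c N)⁻¹
      refine h1.ae_eq (Eventually.of_forall fun ω => ?_)
      simp only
      rw [inv_mul_cancel_left₀ hcN.ne']
    obtain ⟨h1, h2, h3⟩ := hε.average_rows (hF N) hF0 hM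
    refine ⟨h1, ?_⟩
    set e := ∫ ω, F N (fun i => ε (0, i) ω) ∂P
    set V := variance (fun ω => F N (fun i => ε (0, i) ω)) P
    have hV0 : 0 ≤ V := variance_nonneg _ _
    rw [snr, h2, h3, integral_const_mul, variance_const_mul, add_sub_cancel, add_sub_cancel,
      abs_mul, abs_mul, hσ, one_mul, abs_of_pos hcN, ENNReal.ofReal_mul hcN.le]
    have e1 : √(N * (c N ^ 2 * V)) = c N * (√(M * N) * √(V / M)) := by
      rw [← Real.sqrt_mul (by positivity),
        show (M : ℝ) * N * (V / M) = N * V by field_simp,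
        show (N : ℝ) * (c N ^ 2 * V) = c N ^ 2 * (N * V) by ring,
        Real.sqrt_mul (sq_nonneg _), Real.sqrt_sq hcN.le]
    -- The scale `c N` cancels. In `[0, ∞]` only the cancelled factor must be nonzero and finite, so
    -- a zero variance is included.
    rw [e1, ENNReal.ofReal_mul hcN.le, ENNReal.ofReal_mul (Real.sqrt_nonneg _),
      ENNReal.mul_div_mul_left _ _ (by simpa using hcN) ENNReal.ofReal_ne_top]
    have hs : 0 < √((M : ℝ) * N) := Real.sqrt_pos.2 (by positivity)
    have hs1 : ENNReal.ofReal √((M : ℝ) * N) ≠ 0 := by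
      rw [Ne, ENNReal.ofReal_eq_zero, not_le]; exact hs
    rw [← ENNReal.mul_div_mul_left _ _ hs1 ENNReal.ofReal_ne_top, mul_div_assoc]

end IsIID
end VarInf

/-! ### Differentiation along a coordinate line and regularity of the weights -/

namespace VarInf

lemma partialD_update {b : ℕ} (k : Fin b) (g : (Fin b → ℝ) → ℝ) (y : Fin b → ℝ) (t : ℝ) :
    partialD k g (Function.update y k t) = deriv (fun s => g (Function.update y k s)) t := by
  simp [partialD]

lemma partialD_eq_deriv {b : ℕ} (k : Fin b) (g : (Fin b → ℝ) → ℝ) (y : Fin b → ℝ) :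
    partialD k g y = deriv (fun s => g (Function.update y k s)) (y k) := rfl

/-- The derivative is an almost sure limit of difference quotients along one fixed sequence, so no
joint measurability in `(t, e)` is needed. -/
lemma aemeasurable_deriv_of_ae {E : Type*} [MeasurableSpace E] {Q : Measure E}
    {F : ℝ → E → ℝ} {t₀ : ℝ} (hF : ∀ᶠ t in 𝓝 t₀, AEMeasurable (F t) Q)
    (hd : ∀ᵐ e ∂Q, DifferentiableAt ℝ (fun t => F t e) t₀) :
    AEMeasurable (fun e => deriv (fun t => F t e) t₀) Q := by
  obtain ⟨r, hr, hball⟩ := Metric.eventually_nhds_iff_ball.1 hF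
  set u : ℕ → ℝ := fun n => t₀ + r / 2 * (1 / ((n : ℝ) + 1)) with hu
  have hpos : ∀ n : ℕ, 0 < r / 2 * (1 / ((n : ℝ) + 1)) := fun n => by positivity
  have humem : ∀ n, u n ∈ Metric.ball t₀ r := by
    intro n
    rw [Metric.mem_ball, Real.dist_eq, hu, add_sub_cancel_left, abs_of_pos (hpos n)]
    have h1 : 1 / ((n : ℝ) + 1) ≤ 1 := by
      rw [div_le_one (by positivity)]; linarith [n.cast_nonneg (α := ℝ)]
    nlinarith
  have hlim : Tendsto u atTop (𝓝[≠] t₀) := by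
    refine tendsto_nhdsWithin_iff.2 ⟨?_, Eventually.of_forall fun n => ?_⟩
    · simpa [hu] using ((tendsto_one_div_add_atTop_nhds_zero_nat (𝕜 := ℝ)).const_mul
        (r / 2)).const_add t₀
    · have := hpos n
      simp only [hu, Set.mem_compl_iff, Set.mem_singleton_iff]
      linarith
  refine aemeasurable_of_tendsto_metrizable_ae atTop
    (f := fun n e => (u n - t₀)⁻¹ * (F (u n) e - F t₀ e)) (fun n => ?_) ?_
  · exact ((hball _ (humem n)).sub (hball _ (Metric.mem_ball_self hr))).const_mul _
  · filter_upwards [hd] with e he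
    exact (hasDerivAt_iff_tendsto_slope.1 he.hasDerivAt).comp hlim

/-- Differentiation under the integral sign, for pointwise differentiable families with a
dominated derivative. -/
lemma hasDerivAt_integral_of_dominated_deriv {E : Type*} [MeasurableSpace E] {Q : Measure E}
    {F : ℝ → E → ℝ} {t₀ r : ℝ} (hr : 0 < r)
    (hF : ∀ t ∈ Metric.ball t₀ r, AEMeasurable (F t) Q) (hint : Integrable (F t₀) Q)
    (hd : ∀ᵐ e ∂Q, ∀ t ∈ Metric.ball t₀ r, DifferentiableAt ℝ (fun s => F s e) t)
    {G : E → ℝ} (hG : Integrable G Q)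
    (hle : ∀ᵐ e ∂Q, ∀ t ∈ Metric.ball t₀ r, |deriv (fun s => F s e) t| ≤ G e) :
    Integrable (fun e => deriv (fun s => F s e) t₀) Q ∧
    HasDerivAt (fun t => ∫ e, F t e ∂Q) (∫ e, deriv (fun s => F s e) t₀ ∂Q) t₀ ∧
    ∀ t ∈ Metric.ball t₀ r, Integrable (F t) Q := by
  have hball : Metric.ball t₀ r ∈ 𝓝 t₀ := Metric.ball_mem_nhds _ hr
  have hFev : ∀ᶠ t in 𝓝 t₀, AEMeasurable (F t) Q := by
    filter_upwards [hball] with t ht using hF t ht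
  have hm := aemeasurable_deriv_of_ae hFev (hd.mono fun e he => he _ (Metric.mem_ball_self hr))
  have h := hasDerivAt_integral_of_dominated_loc_of_deriv_le (μ := Q) (F := F) (x₀ := t₀)
    (F' := fun t e => deriv (fun s => F s e) t) hball
    (hFev.mono fun t ht => ht.aestronglyMeasurable) hint hm.aestronglyMeasurable hle hG
    (hd.mono fun e he t ht => (he t ht).hasDerivAt)
  refine ⟨h.1, h.2, fun t ht => ?_⟩
  -- Mean value inequality: the increment is dominated by `|t - t₀| G`.
  have hdiff : Integrable (fun e => F t e - F t₀ e) Q := by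
    refine (hG.mul_const |t - t₀|).mono'
      ((hF t ht).sub (hF _ (Metric.mem_ball_self hr))).aestronglyMeasurable ?_
    filter_upwards [hd, hle] with e he he'
    exact (convex_ball t₀ r).norm_image_sub_le_of_norm_deriv_le (fun x hx => he x hx)
      (fun x hx => he' x hx) (Metric.mem_ball_self hr) ht
  exact (hdiff.add hint).congr (Eventually.of_forall fun e => by simp)

namespace Model

variable {a b d : ℕ} {E : Type*} [MeasurableSpace E] {S : Model a b d E}

namespace Standing

lemma nu_ne_zero (hS : S.Standing) {φ : Fin b → ℝ} (hφ : φ ∈ S.Φ) : S.ν ≠ 0 := by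
  intro h
  have h1 := hS.q_integral φ hφ
  rw [h, integral_zero_measure] at h1
  exact zero_ne_one h1

/-- With evidence `0` the quotient defining the posterior would be `0` everywhere, against its
almost everywhere positivity; `φ` serves only to know that `ν ≠ 0`. -/
lemma evidence_ne_zero (hS : S.Standing) {θ : Fin a → ℝ} (hθ : θ ∈ S.Θ) {φ : Fin b → ℝ}
    (hφ : φ ∈ S.Φ) : S.evidence θ ≠ 0 := by
  intro h
  have : NeZero S.ν := ⟨hS.nu_ne_zero hφ⟩
  obtain ⟨z, hz⟩ := (hS.posterior_pos θ hθ).exists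
  simp [posterior, h] at hz

/-- The joint density inherits differentiability in `z` from the posterior, of which it is a
constant multiple. -/
lemma differentiable_p (hS : S.Standing) {θ : Fin a → ℝ} (hθ : θ ∈ S.Θ) {φ : Fin b → ℝ}
    (hφ : φ ∈ S.Φ) : Differentiable ℝ (S.p θ) := by
  intro z
  have h1 : DifferentiableAt ℝ (fun y : (Fin d → ℝ) × (Fin a → ℝ) => S.posterior y.2 y.1)
      (z, θ) :=
    hS.posterior_diff.differentiableAt ((isOpen_univ.prod hS.isOpen_Θ).mem_nhds ⟨trivial, hθ⟩)
  have h2 : DifferentiableAt ℝ (fun z' => S.posterior θ z' * S.evidence θ) z :=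
    (h1.comp z (f := fun z' => (z', θ)) (by fun_prop)).mul_const _
  refine h2.congr_of_eventuallyEq (Eventually.of_forall fun z' => ?_)
  simp only [posterior]
  rw [div_mul_cancel₀ _ (hS.evidence_ne_zero hθ hφ)]

lemma differentiableAt_q (hS : S.Standing) {φ : Fin b → ℝ} (hφ : φ ∈ S.Φ) (z : Fin d → ℝ) :
    DifferentiableAt ℝ (fun y : (Fin d → ℝ) × (Fin b → ℝ) => S.q y.2 y.1) (z, φ) :=
  hS.q_diff.differentiableAt ((isOpen_univ.prod hS.isOpen_Φ).mem_nhds ⟨trivial, hφ⟩)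

lemma measurable_q (hS : S.Standing) {φ : Fin b → ℝ} (hφ : φ ∈ S.Φ) : Measurable (S.q φ) := by
  have : Differentiable ℝ (S.q φ) := fun z =>
    (hS.differentiableAt_q hφ z).comp z (f := fun z' => (z', φ)) (by fun_prop)
  exact this.continuous.measurable

lemma measurable_w (hS : S.Standing) {θ : Fin a → ℝ} (hθ : θ ∈ S.Θ) {φ : Fin b → ℝ}
    (hφ : φ ∈ S.Φ) : Measurable (S.w θ φ) :=
  (hS.differentiable_p hθ hφ).continuous.measurable.div (hS.measurable_q hφ)

lemma aemeasurable_wt (hS : S.Standing) {θ : Fin a → ℝ} (hθ : θ ∈ S.Θ) {φ φ' : Fin b → ℝ}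
    (hφ : φ ∈ S.Φ) (hφ' : φ' ∈ S.Φ) : AEMeasurable (fun e => S.wt θ φ e φ') S.Q :=
  (hS.measurable_w hθ hφ).comp_aemeasurable (hS.reparam φ' hφ').aemeasurable

lemma integral_qLaw (hS : S.Standing) {φ : Fin b → ℝ} (hφ : φ ∈ S.Φ) (g : (Fin d → ℝ) → ℝ) :
    ∫ z, g z ∂S.qLaw φ = ∫ z, S.q φ z * g z ∂S.ν := by
  rw [qLaw, integral_withDensity_eq_integral_toReal_smul (hS.measurable_q hφ).ennreal_ofReal
    (Eventually.of_forall fun _ => ENNReal.ofReal_lt_top)]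
  refine integral_congr_ae (Eventually.of_forall fun z => ?_)
  simp only [smul_eq_mul, ENNReal.toReal_ofReal (hS.q_nonneg φ hφ z)]

lemma integral_comp_f (hS : S.Standing) {φ : Fin b → ℝ} (hφ : φ ∈ S.Φ) {g : (Fin d → ℝ) → ℝ}
    (hg : Measurable g) : ∫ e, g (S.f e φ) ∂S.Q = ∫ z, g z ∂S.qLaw φ :=
  (hS.reparam φ hφ).integral_comp hg.aestronglyMeasurable

/-- Almost sure positivity and differentiability of the weights along a coordinate line. -/
lemma ae_line (hS : S.Standing) {θ : Fin a → ℝ} (hθ : θ ∈ S.Θ) {φ : Fin b → ℝ}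
    (hφ : φ ∈ S.Φ) (k : Fin b) :
    ∀ᵐ e ∂S.Q, ∀ t, Function.update φ k t ∈ S.Φ →
      (0 < S.wt θ φ e (Function.update φ k t) ∧
        DifferentiableAt ℝ (fun s => S.wt θ φ e (Function.update φ k s)) t) ∧
      (0 < S.wt θ (Function.update φ k t) e (Function.update φ k t) ∧
        DifferentiableAt ℝ
          (fun s => S.wt θ (Function.update φ k s) e (Function.update φ k s)) t) ∧
      (0 < S.q (Function.update φ k t) (S.f e φ) ∧
        DifferentiableAt ℝ (fun s => S.q (Function.update φ k s) (S.f e φ)) t) := by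
  filter_upwards [hS.f_diff, hS.weights_pos] with e hf hw t ht
  have hu : DifferentiableAt ℝ (fun s => Function.update φ k s) t :=
    (hasDerivAt_update φ k t).differentiableAt
  have hft : DifferentiableAt ℝ (fun s => S.f e (Function.update φ k s)) t :=
    DifferentiableAt.comp t (hf.differentiableAt (hS.isOpen_Φ.mem_nhds ht)) hu
  have hp : DifferentiableAt ℝ (fun s => S.p θ (S.f e (Function.update φ k s))) t :=
    DifferentiableAt.comp t ((hS.differentiable_p hθ hφ) _) hft
  have hq1 : DifferentiableAt ℝ (fun s => S.q φ (S.f e (Function.update φ k s))) t :=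
    (hS.differentiableAt_q hφ _).comp t
      (f := fun s => (S.f e (Function.update φ k s), φ)) (hft.prodMk (by fun_prop))
  have hq2 : DifferentiableAt ℝ
      (fun s => S.q (Function.update φ k s) (S.f e (Function.update φ k s))) t :=
    (hS.differentiableAt_q ht _).comp t
      (f := fun s => (S.f e (Function.update φ k s), Function.update φ k s)) (hft.prodMk hu)
  have hq3 : DifferentiableAt ℝ (fun s => S.q (Function.update φ k s) (S.f e φ)) t :=
    (hS.differentiableAt_q ht _).comp t
      (f := fun s => (S.f e φ, Function.update φ k s)) ((differentiableAt_const _).prodMk hu)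
  have h1 := hw θ hθ φ hφ _ ht
  have h2 := hw θ hθ _ ht _ ht
  have h3 := hw θ hθ _ ht φ hφ
  exact ⟨⟨div_pos h1.1 h1.2, hp.div hq1 h1.2.ne'⟩, ⟨div_pos h2.1 h2.2, hp.div hq2 h2.2.ne'⟩,
    h3.2, hq3⟩

/-- The total derivative of the weights along a coordinate line, in terms of its two partial
derivatives. -/
lemma ae_deriv_line (hS : S.Standing) {θ : Fin a → ℝ} (hθ : θ ∈ S.Θ) {φ : Fin b → ℝ}
    (hφ : φ ∈ S.Φ) (k : Fin b) :
    ∀ᵐ e ∂S.Q,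
      deriv (fun s => S.wt θ (Function.update φ k s) e (Function.update φ k s)) (φ k) =
      deriv (fun s => S.wt θ φ e (Function.update φ k s)) (φ k) - S.wt θ φ e φ *
        (deriv (fun s => S.q (Function.update φ k s) (S.f e φ)) (φ k) / S.q φ (S.f e φ)) := by
  filter_upwards [hS.f_diff, hS.weights_pos] with e hf hw
  have hself : Function.update φ k (φ k) = φ := Function.update_eq_self k φ
  have hu : HasDerivAt (fun s => Function.update φ k s) (Pi.single k (1 : ℝ)) (φ k) :=
    hasDerivAt_update φ k (φ k)
  have hfd : DifferentiableAt ℝ (S.f e) (Function.update φ k (φ k)) := by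
    rw [hself]; exact hf.differentiableAt (hS.isOpen_Φ.mem_nhds hφ)
  have hft : HasDerivAt (fun s => S.f e (Function.update φ k s)) _ (φ k) :=
    hfd.hasFDerivAt.comp_hasDerivAt (φ k) hu
  set f' := (fderiv ℝ (S.f e) (Function.update φ k (φ k))) (Pi.single k (1 : ℝ))
  have hpd : DifferentiableAt ℝ (fun s => S.p θ (S.f e (Function.update φ k s))) (φ k) :=
    DifferentiableAt.comp (φ k) ((hS.differentiable_p hθ hφ) _) hft.differentiableAt
  have hqd := (hS.differentiableAt_q hφ (S.f e φ)).hasFDerivAt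
  set L := fderiv ℝ (fun y : (Fin d → ℝ) × (Fin b → ℝ) => S.q y.2 y.1) (S.f e φ, φ)
  have hq1 : HasDerivAt (fun s => S.q φ (S.f e (Function.update φ k s))) (L (f', 0)) (φ k) := by
    refine HasFDerivAt.comp_hasDerivAt_of_eq (φ k) hqd (hft.prodMk (hasDerivAt_const _ φ)) ?_
    rw [hself]
  have hq2 : HasDerivAt (fun s => S.q (Function.update φ k s) (S.f e (Function.update φ k s)))
      (L (f', Pi.single k 1)) (φ k) := by
    refine HasFDerivAt.comp_hasDerivAt_of_eq (φ k) hqd (hft.prodMk hu) ?_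
    rw [hself]
  have hq3 : HasDerivAt (fun s => S.q (Function.update φ k s) (S.f e φ))
      (L (0, Pi.single k 1)) (φ k) := by
    refine HasFDerivAt.comp_hasDerivAt_of_eq (φ k) hqd ((hasDerivAt_const _ _).prodMk hu) ?_
    rw [hself]
  have hq0 : S.q φ (S.f e φ) ≠ 0 := (hw θ hθ φ hφ φ hφ).2.ne'
  -- The direction in which both arguments of `q` move splits into moving the sample and moving the
  -- parameter; the second piece is the score term.
  have hL : L (f', Pi.single k 1) = L (f', 0) + L (0, Pi.single k 1) := by
    rw [← map_add]; simp
  have h1 := (hpd.hasDerivAt.div hq1 (by rwa [hself])).deriv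
  have h2 := (hpd.hasDerivAt.div hq2 (by rwa [hself])).deriv
  change deriv ((fun s => S.p θ (S.f e (Function.update φ k s))) /
      (fun s => S.q (Function.update φ k s) (S.f e (Function.update φ k s)))) (φ k) =
    deriv ((fun s => S.p θ (S.f e (Function.update φ k s))) /
      (fun s => S.q φ (S.f e (Function.update φ k s)))) (φ k) - _
  rw [h1, h2, hq3.deriv, hL]
  simp only [hself, wt, w]
  field_simp
  ring

end Standing

end Model
end VarInf

/-! ### Derivatives of the moments of the weights, of the bound and of `γ²` -/

namespace VarInf
namespace Model

variable {a b d : ℕ} {E : Type*} [MeasurableSpace E] {S : Model a b d E}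

lemma IsCoordNhd.exists_ball {k : Fin b} {θ : Fin a → ℝ} {φ : Fin b → ℝ}
    {V : Set ((Fin a → ℝ) × (Fin b → ℝ))} (hV : IsCoordNhd k θ φ V) :
    ∃ r > 0, ∀ t ∈ Metric.ball (φ k) r, (θ, Function.update φ k t) ∈ V := by
  obtain ⟨r, hr, h⟩ := hV
  exact ⟨r, hr, fun t ht => h t (by rwa [← Real.ball_eq_Ioo])⟩

namespace Standing

lemma update_mem (hS : S.Standing) {φ : Fin b → ℝ} (hφ : φ ∈ S.Φ) (k : Fin b) :
    ∀ᶠ t in 𝓝 (φ k), Function.update φ k t ∈ S.Φ := by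
  have hc : ContinuousAt (fun t => Function.update φ k t) (φ k) :=
    (hasDerivAt_update φ k (φ k)).continuousAt
  refine hc.eventually (hS.isOpen_Φ.mem_nhds ?_)
  simpa only [Function.update_eq_self] using hφ

/-- Change of measure: the reparameterized integral as an integral against the density ratio. -/
lemma integral_wt_rpow_eq (hS : S.Standing) {θ : Fin a → ℝ} (hθ : θ ∈ S.Θ) {φ φ' : Fin b → ℝ}
    (hφ : φ ∈ S.Φ) (hφ' : φ' ∈ S.Φ) (c : ℝ) :
    ∫ e, S.wt θ φ e φ' ^ c ∂S.Q =
      ∫ e, S.wt θ φ e φ ^ c * (S.q φ' (S.f e φ) / S.q φ (S.f e φ)) ∂S.Q := by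
  have hw := hS.measurable_w hθ hφ
  have h1 : ∫ e, S.wt θ φ e φ' ^ c ∂S.Q = ∫ z, S.w θ φ z ^ c ∂S.qLaw φ' :=
    hS.integral_comp_f hφ' (g := fun z => S.w θ φ z ^ c) (hw.pow_const c)
  have h2 : ∫ e, S.wt θ φ e φ ^ c * (S.q φ' (S.f e φ) / S.q φ (S.f e φ)) ∂S.Q =
      ∫ z, S.w θ φ z ^ c * (S.q φ' z / S.q φ z) ∂S.qLaw φ :=
    hS.integral_comp_f hφ (g := fun z => S.w θ φ z ^ c * (S.q φ' z / S.q φ z))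
      ((hw.pow_const c).mul ((hS.measurable_q hφ').div (hS.measurable_q hφ)))
  rw [h1, h2, hS.integral_qLaw hφ', hS.integral_qLaw hφ]
  refine integral_congr_ae ?_
  filter_upwards [hS.q_pos φ hφ] with z hz
  field_simp

/-- Differentiation of the moments of the weights along a coordinate line. Here `B` is the mean of
the derivative of the reparameterized weights, the parameter of the weights being fixed; the total
derivative is a multiple of `B`. -/
theorem hasDerivAt_moments (hS : S.Standing) {θ : Fin a → ℝ} (hθ : θ ∈ S.Θ) {φ : Fin b → ℝ}
    (hφ : φ ∈ S.Φ) {k : Fin b} {c : ℝ} {V : Set ((Fin a → ℝ) × (Fin b → ℝ))}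
    (hVsub : V ⊆ S.Θ ×ˢ S.Φ) (hV : IsCoordNhd k θ φ V) (hdom : S.DominatedOn c k θ φ V)
    (hint : Integrable (fun e => S.wt θ φ e φ ^ c) S.Q) :
    Integrable (fun e => partialD k (fun φ' => S.wt θ φ e φ' ^ c) φ) S.Q ∧
    HasDerivAt (fun t => ∫ e, S.wt θ φ e (Function.update φ k t) ^ c ∂S.Q)
      (∫ e, partialD k (fun φ' => S.wt θ φ e φ' ^ c) φ ∂S.Q) (φ k) ∧
    HasDerivAt (fun t => ∫ e, S.wt θ (Function.update φ k t) e (Function.update φ k t) ^ c ∂S.Q)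
      ((1 - c) * ∫ e, partialD k (fun φ' => S.wt θ φ e φ' ^ c) φ ∂S.Q) (φ k) ∧
    ∀ᶠ t in 𝓝 (φ k), Integrable
      (fun e => S.wt θ (Function.update φ k t) e (Function.update φ k t) ^ c) S.Q := by
  obtain ⟨r, hr, hball⟩ := hV.exists_ball
  have hmem : ∀ t ∈ Metric.ball (φ k) r, Function.update φ k t ∈ S.Φ := fun t ht =>
    (hVsub (hball t ht)).2
  have hself : Function.update φ k (φ k) = φ := Function.update_eq_self k φ
  obtain ⟨⟨G₁, hG₁, hle₁⟩, ⟨G₂, hG₂, hle₂⟩, ⟨G₃, hG₃, hle₃⟩⟩ := hdom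
  have hline := hS.ae_line hθ hφ k
  -- moving both parameters
  have h1 := hasDerivAt_integral_of_dominated_deriv (Q := S.Q) hr
    (F := fun t e => S.wt θ (Function.update φ k t) e (Function.update φ k t) ^ c)
    (fun t ht => (hS.aemeasurable_wt hθ (hmem t ht) (hmem t ht)).pow_const c)
    (by simpa only [hself] using hint)
    (by
      filter_upwards [hline] with e he t ht
      obtain ⟨hpos, hd⟩ := (he t (hmem t ht)).2.1
      exact hd.rpow_const (Or.inl hpos.ne'))
    hG₁
    (by
      filter_upwards [hle₁] with e he t ht
      have := he _ (hball t ht)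
      rwa [partialD_update] at this)
  -- moving the parameter of the reparameterization
  have h2 := hasDerivAt_integral_of_dominated_deriv (Q := S.Q) hr
    (F := fun t e => S.wt θ φ e (Function.update φ k t) ^ c)
    (fun t ht => (hS.aemeasurable_wt hθ hφ (hmem t ht)).pow_const c)
    (by simpa only [hself] using hint)
    (by
      filter_upwards [hline] with e he t ht
      obtain ⟨hpos, hd⟩ := (he t (hmem t ht)).1
      exact hd.rpow_const (Or.inl hpos.ne'))
    hG₂
    (by
      filter_upwards [hle₂] with e he t ht
      have := he _ (hball t ht)
      rwa [partialD_update] at this)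
  -- moving the density
  have hlaw := hS.reparam φ hφ
  have hG₃' : Integrable (fun e => G₃ (S.f e φ)) S.Q := by
    rw [← hlaw.map_eq] at hG₃
    exact (integrable_map_measure hG₃.aestronglyMeasurable hlaw.aemeasurable).1 hG₃
  have hle₃' : ∀ᵐ e ∂S.Q, ∀ φ', (θ, φ') ∈ V →
      S.w θ φ (S.f e φ) ^ c * |partialD k (fun φ'' => Real.log (S.q φ'' (S.f e φ))) φ' *
        (S.q φ' (S.f e φ) / S.q φ (S.f e φ))| ≤ G₃ (S.f e φ) := by
    rw [← hlaw.map_eq] at hle₃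
    exact ae_of_ae_map hlaw.aemeasurable hle₃
  have hderiv₃ : ∀ e t, deriv (fun s => S.wt θ φ e φ ^ c *
      (S.q (Function.update φ k s) (S.f e φ) / S.q φ (S.f e φ))) t = S.wt θ φ e φ ^ c *
      (deriv (fun s => S.q (Function.update φ k s) (S.f e φ)) t / S.q φ (S.f e φ)) := by
    intro e t
    rw [deriv_const_mul_field, deriv_div_const]
  have h3 := hasDerivAt_integral_of_dominated_deriv (Q := S.Q) hr
    (F := fun t e => S.wt θ φ e φ ^ c *
      (S.q (Function.update φ k t) (S.f e φ) / S.q φ (S.f e φ)))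
    (fun t ht => ((hS.aemeasurable_wt hθ hφ hφ).pow_const c).mul
      (((hS.measurable_q (hmem t ht)).comp_aemeasurable hlaw.aemeasurable).div
        ((hS.measurable_q hφ).comp_aemeasurable hlaw.aemeasurable)))
    (by
      refine hint.congr ?_
      filter_upwards [hline] with e he
      have h := (he (φ k) (by rwa [hself])).2.2.1
      rw [hself] at h ⊢
      rw [div_self h.ne', mul_one])
    (by
      filter_upwards [hline] with e he t ht
      exact ((he t (hmem t ht)).2.2.2.div_const _).const_mul _)
    hG₃'
    (by
      filter_upwards [hle₃', hline] with e he hl t ht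
      have h := he _ (hball t ht)
      obtain ⟨hpos, hd⟩ := (hl t (hmem t ht)).2.2
      have hw := (hl (φ k) (by rwa [hself])).1.1
      rw [hself] at hw
      rw [partialD_update, (hd.hasDerivAt.log hpos.ne').deriv] at h
      rw [hderiv₃, abs_mul, abs_of_nonneg (Real.rpow_nonneg hw.le c)]
      refine le_of_eq_of_le ?_ h
      rw [wt]
      congr 2
      field_simp)
  simp only [partialD_eq_deriv]
  -- By change of measure the same function of `t` is obtained by moving the density at a fixed
  -- sample. Uniqueness of derivatives then equates the means of the reparameterized and of the
  -- score derivative.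
  have hB : HasDerivAt (fun t => ∫ e, S.wt θ φ e (Function.update φ k t) ^ c ∂S.Q)
      (∫ e, deriv (fun s => S.wt θ φ e φ ^ c *
        (S.q (Function.update φ k s) (S.f e φ) / S.q φ (S.f e φ))) (φ k) ∂S.Q) (φ k) := by
    refine h3.2.1.congr_of_eventuallyEq ?_
    filter_upwards [hS.update_mem hφ k] with t ht using hS.integral_wt_rpow_eq hθ hφ ht c
  have hB' := hB.unique h2.2.1
  refine ⟨h2.1, h2.2.1, ?_, ?_⟩
  -- Pointwise, the total derivative is the reparameterized one minus `c` times the score term;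
  -- since both have the same mean, the factor `1 - c` appears.
  · have h4 : ∫ e, deriv (fun s =>
        S.wt θ (Function.update φ k s) e (Function.update φ k s) ^ c) (φ k) ∂S.Q =
        ∫ e, deriv (fun s => S.wt θ φ e (Function.update φ k s) ^ c) (φ k) -
          c * deriv (fun s => S.wt θ φ e φ ^ c *
            (S.q (Function.update φ k s) (S.f e φ) / S.q φ (S.f e φ))) (φ k) ∂S.Q := by
      refine integral_congr_ae ?_
      filter_upwards [hline, hS.ae_deriv_line hθ hφ k] with e he hde
      obtain ⟨⟨hp1, hd1⟩, ⟨hp2, hd2⟩, -⟩ := he (φ k) (by rwa [hself])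
      rw [hderiv₃, (hd2.hasDerivAt.rpow_const (p := c) (Or.inl hp2.ne')).deriv,
        (hd1.hasDerivAt.rpow_const (p := c) (Or.inl hp1.ne')).deriv, hde]
      rw [hself] at hp1 ⊢
      have h5 : S.wt θ φ e φ ^ c = S.wt θ φ e φ ^ (c - 1) * S.wt θ φ e φ := by
        rw [← Real.rpow_add_one hp1.ne', sub_add_cancel]
      rw [h5]
      ring
    have h6 := h1.2.1
    rw [h4, integral_sub h2.1 (h3.1.const_mul c), integral_const_mul, hB'] at h6
    convert h6 using 1
    ring
  · filter_upwards [Metric.ball_mem_nhds (φ k) hr] with t ht using h1.2.2 t ht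

/-- The mean of the weights is the evidence. -/
lemma integral_w_qLaw (hS : S.Standing) {θ : Fin a → ℝ} {φ : Fin b → ℝ} (hφ : φ ∈ S.Φ) :
    ∫ z, S.w θ φ z ∂S.qLaw φ = S.evidence θ := by
  rw [hS.integral_qLaw hφ, evidence]
  refine integral_congr_ae ?_
  filter_upwards [hS.q_pos φ hφ] with z hz
  rw [w, mul_div_cancel₀ _ hz.ne']

lemma integral_wt (hS : S.Standing) {θ : Fin a → ℝ} (hθ : θ ∈ S.Θ) {φ : Fin b → ℝ}
    (hφ : φ ∈ S.Φ) : ∫ e, S.wt θ φ e φ ∂S.Q = S.evidence θ := by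
  rw [← hS.integral_w_qLaw hφ]
  exact hS.integral_comp_f hφ (hS.measurable_w hθ hφ)

lemma VR_eq (hS : S.Standing) {θ : Fin a → ℝ} (hθ : θ ∈ S.Θ) {φ : Fin b → ℝ}
    (hφ : φ ∈ S.Φ) (α : ℝ) :
    S.VR α θ φ = 1 / (1 - α) * Real.log (∫ e, S.wt θ φ e φ ^ (1 - α) ∂S.Q) := by
  rw [VR, ← hS.integral_comp_f hφ ((hS.measurable_w hθ hφ).pow_const _)]
  rfl

lemma gammaSq_zero_eq (hS : S.Standing) {θ : Fin a → ℝ} (hθ : θ ∈ S.Θ) {φ : Fin b → ℝ}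
    (hφ : φ ∈ S.Φ) (hint : Integrable (fun e => S.wt θ φ e φ ^ (2 : ℝ)) S.Q) :
    S.gammaSq 0 θ φ =
      (∫ e, S.wt θ φ e φ ^ (2 : ℝ) ∂S.Q) / (∫ e, S.wt θ φ e φ ∂S.Q) ^ 2 - 1 := by
  have hlaw := hS.reparam φ hφ
  have hw := hS.measurable_w hθ hφ
  have hne := hS.evidence_ne_zero hθ hφ
  have := hS.isProb
  have : IsProbabilityMeasure (S.qLaw φ) := hlaw.isProbabilityMeasure_iff.1 inferInstance
  simp only [Real.rpow_two] at hint ⊢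
  have hint' : Integrable (fun z => S.w θ φ z ^ 2) (S.qLaw φ) := by
    rw [← hlaw.map_eq]
    exact (integrable_map_measure (hw.pow_const 2).aestronglyMeasurable hlaw.aemeasurable).2 hint
  have hL : MemLp (S.w θ φ) 2 (S.qLaw φ) :=
    (memLp_two_iff_integrable_sq hw.aestronglyMeasurable).2 hint'
  have hI : ∫ e, S.wt θ φ e φ ^ 2 ∂S.Q = ∫ z, S.w θ φ z ^ 2 ∂S.qLaw φ :=
    hS.integral_comp_f hφ (hw.pow_const 2)
  rw [gammaSq, hS.integral_wt hθ hφ, hI]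
  simp only [sub_zero, Real.rpow_one, div_one, one_mul]
  rw [hS.integral_w_qLaw hφ, variance_eq_sub (by
    simp only [div_eq_mul_inv]; exact hL.mul_const _)]
  simp only [Pi.pow_apply, div_pow]
  rw [integral_div, integral_div, hS.integral_w_qLaw hφ, div_self hne, one_pow]

theorem hasDerivAt_VR (hS : S.Standing) {θ : Fin a → ℝ} (hθ : θ ∈ S.Θ) {φ : Fin b → ℝ}
    (hφ : φ ∈ S.Φ) {k : Fin b} {α : ℝ} (hα : α < 1)
    {B : ℝ} (hpos : 0 < ∫ e, S.wt θ φ e φ ^ (1 - α) ∂S.Q)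
    (hB : HasDerivAt (fun t => ∫ e, S.wt θ (Function.update φ k t) e (Function.update φ k t)
      ^ (1 - α) ∂S.Q) ((1 - (1 - α)) * B) (φ k)) :
    HasDerivAt (fun t => S.VR α θ (Function.update φ k t))
      (α * (B / (1 - α)) / ∫ e, S.wt θ φ e φ ^ (1 - α) ∂S.Q) (φ k) := by
  have h1 := (hB.log (by rw [Function.update_eq_self]; exact hpos.ne')).const_mul (1 / (1 - α))
  have h2 := h1.congr_of_eventuallyEq (f₁ := fun t => S.VR α θ (Function.update φ k t)) (by
    filter_upwards [hS.update_mem hφ k] with t ht using hS.VR_eq hθ ht α)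
  refine h2.congr_deriv ?_
  rw [Function.update_eq_self]
  have : 1 - α ≠ 0 := by linarith
  field_simp
  ring

/-- Only the second moment varies, because the mean of the weights is the evidence. Square
integrability near `φ k` is needed for `gammaSq_zero_eq` to hold at neighbouring parameters. -/
theorem hasDerivAt_gammaSq_zero (hS : S.Standing) {θ : Fin a → ℝ} (hθ : θ ∈ S.Θ)
    {φ : Fin b → ℝ} (hφ : φ ∈ S.Φ) {k : Fin b} {B : ℝ}
    (hB : HasDerivAt (fun t => ∫ e, S.wt θ (Function.update φ k t) e (Function.update φ k t)
      ^ (2 : ℝ) ∂S.Q) ((1 - 2) * B) (φ k))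
    (hint : ∀ᶠ t in 𝓝 (φ k), Integrable
      (fun e => S.wt θ (Function.update φ k t) e (Function.update φ k t) ^ (2 : ℝ)) S.Q) :
    HasDerivAt (fun t => S.gammaSq 0 θ (Function.update φ k t))
      (-B / (∫ e, S.wt θ φ e φ ∂S.Q) ^ 2) (φ k) := by
  have h1 := (hB.div_const ((∫ e, S.wt θ φ e φ ∂S.Q) ^ 2)).sub_const 1
  have h2 := h1.congr_of_eventuallyEq
    (f₁ := fun t => S.gammaSq 0 θ (Function.update φ k t)) (by
      filter_upwards [hS.update_mem hφ k, hint] with t ht hti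
      rw [hS.gammaSq_zero_eq hθ ht hti, hS.integral_wt hθ hφ, hS.integral_wt hθ ht])
  exact h2.congr_deriv (by ring)

end Standing
end Model
end VarInf

/-! ### Measurable versions and the reduction to row estimators -/

namespace VarInf

lemma memLp_two_of_integrable_rpow {E : Type*} [MeasurableSpace E] {Q : Measure E}
    [IsProbabilityMeasure Q] {f : E → ℝ} (hf : AEMeasurable f Q) {p : ℝ} (hp : 2 < p)
    (hint : Integrable (fun e => |f e| ^ p) Q) : MemLp f 2 Q := by
  have h1 : MemLp f (ENNReal.ofReal p) Q := by
    rw [← integrable_norm_rpow_iff hf.aestronglyMeasurable (by simpa using by linarith)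
      ENNReal.ofReal_ne_top, ENNReal.toReal_ofReal (by linarith)]
    exact hint
  refine h1.mono_exponent ?_
  rw [← ENNReal.ofReal_ofNat]
  exact ENNReal.ofReal_le_ofReal hp.le

lemma snr_congr {Ω : Type*} [MeasurableSpace Ω] {P : Measure Ω} {X Y : Ω → ℝ} (h : X =ᵐ[P] Y) :
    snr P X = snr P Y := by
  rw [snr, snr, integral_congr_ae h, variance_congr h]

/-- The value `1` is substituted on a null set, so that sums of the new function are positive
everywhere and not just almost surely. -/
lemma exists_measurable_pos {E : Type*} [MeasurableSpace E] {Q : Measure E} {f : E → ℝ}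
    (hf : AEMeasurable f Q) (hpos : ∀ᵐ e ∂Q, 0 < f e) :
    ∃ g : E → ℝ, Measurable g ∧ (∀ e, 0 < g e) ∧ g =ᵐ[Q] f := by
  refine ⟨fun e => if 0 < hf.mk f e then hf.mk f e else 1,
    Measurable.ite (measurableSet_lt measurable_const hf.measurable_mk) hf.measurable_mk
      measurable_const, fun e => ?_, ?_⟩
  · dsimp only
    split_ifs with h
    · exact h
    · exact one_pos
  · filter_upwards [hpos, hf.ae_eq_mk] with e he he'
    rw [← he', if_pos he]

lemma rowEstimator_eq_sum {E : Type*} (α : ℝ) (X D : E → ℝ) (N : ℕ) (y : ℕ → E) :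
    rowEstimator α X (fun e => X e * D e) (fun e => X e ^ 2 * D e) N y =
      ∑ j ∈ Finset.range N, (α * (X (y j) / ∑ l ∈ Finset.range N, X (y l)) +
        (1 - α) * (X (y j) / ∑ l ∈ Finset.range N, X (y l)) ^ 2) * D (y j) := by
  simp only [rowEstimator, div_eq_mul_inv, Finset.mul_sum, Finset.sum_mul,
    ← Finset.sum_add_distrib]
  refine Finset.sum_congr rfl fun j _ => ?_
  ring

/-- The estimator as a function of a finite tuple of noise variables. -/
noncomputable def tupleEstimator {E : Type*} (α : ℝ) (X A B : E → ℝ) (N : ℕ) (y : Fin N → E) : ℝ :=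
  α * ((∑ j, A (y j)) / ∑ j, X (y j)) + (1 - α) * ((∑ j, B (y j)) / (∑ j, X (y j)) ^ 2)

lemma rowEstimator_eq_tupleEstimator {E : Type*} (α : ℝ) (X A B : E → ℝ) (N : ℕ) (y : ℕ → E) :
    rowEstimator α X A B N y = tupleEstimator α X A B N (fun i => y i) := by
  simp only [rowEstimator, tupleEstimator, Finset.sum_range]

lemma measurable_tupleEstimator {E : Type*} [MeasurableSpace E] (α : ℝ) {X A B : E → ℝ}
    (hX : Measurable X) (hA : Measurable A) (hB : Measurable B) (N : ℕ) :
    Measurable (tupleEstimator α X A B N) := by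
  unfold tupleEstimator
  fun_prop

lemma rowEstimator_congr {E : Type*} {α : ℝ} {X A B X' A' B' : E → ℝ} {N : ℕ} {y y' : ℕ → E}
    (hX : ∀ j, X (y j) = X' (y' j)) (hA : ∀ j, A (y j) = A' (y' j))
    (hB : ∀ j, B (y j) = B' (y' j)) :
    rowEstimator α X A B N y = rowEstimator α X' A' B' N y' := by
  simp only [rowEstimator, hX, hA, hB]

namespace IsIID

variable {Ω E : Type*} [MeasurableSpace Ω] [MeasurableSpace E] {ε : ℕ → Ω → E}
  {Q : Measure E} {P : Measure Ω} [IsProbabilityMeasure P]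

/-- A negative moment of order larger than `1` of an empirical mean gives a finite first negative
moment of the sum. -/
lemma lintegral_inv_sum_ne_top (hε : IsIID ε Q P) {X : E → ℝ} (hX : Measurable X)
    (hX0 : ∀ e, 0 < X e) {μ : ℝ} (hμ : 1 < μ) {n : ℕ} (hn : 1 ≤ n)
    (hint : Integrable (fun ω => |(1 / (n : ℝ)) * ∑ j ∈ Finset.range n, X (ε j ω)| ^ (-μ)) P) :
    ∫⁻ ω, ENNReal.ofReal (∑ l ∈ Finset.range n, X (ε l ω))⁻¹ ∂P ≠ ⊤ := by
  have hn1 : (1 : ℝ) ≤ n := by exact_mod_cast hn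
  have hI : Integrable (fun ω => (∑ l ∈ Finset.range n, X (ε l ω))⁻¹) P := by
    refine ((integrable_const (1 : ℝ)).add hint).mono'
      (hε.measurable_sum hX n).inv.aestronglyMeasurable (Eventually.of_forall fun ω => ?_)
    set s := ∑ l ∈ Finset.range n, X (ε l ω)
    have hs : 0 < s := Finset.sum_pos (fun l _ => hX0 _) ⟨0, Finset.mem_range.2 (by omega)⟩
    set u := 1 / (n : ℝ) * s with hu
    have hu0 : 0 < u := by positivity
    have hus : u ≤ s := by
      rw [hu, one_div, ← div_eq_inv_mul]
      exact div_le_self hs.le hn1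
    simp only [Pi.add_apply]
    rw [Real.norm_of_nonneg (inv_nonneg.2 hs.le), abs_of_pos hu0]
    have h1 : s⁻¹ ≤ u⁻¹ := inv_anti₀ hu0 hus
    -- Since `μ > 1`, the inverse is at most `1` or at most `u ^ (-μ)`.
    rcases le_total 1 u with h | h
    · have h2 : u⁻¹ ≤ 1 := inv_le_one_of_one_le₀ h
      have h3 : 0 ≤ u ^ (-μ) := Real.rpow_nonneg hu0.le _
      linarith
    · have h2 : u ^ (-1 : ℝ) ≤ u ^ (-μ) :=
        Real.rpow_le_rpow_of_exponent_ge hu0 h (by linarith)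
      rw [Real.rpow_neg_one] at h2
      linarith
  rw [← ofReal_integral_eq_lintegral_ofReal hI (Eventually.of_forall fun ω =>
    inv_nonneg.2 (Finset.sum_nonneg fun l _ => (hX0 _).le))]
  exact ENNReal.ofReal_ne_top

end IsIID

/-- `HasLaw` gives only almost everywhere measurability; measurable versions have the same law and
stay independent. -/
lemma IsIID.mk_of_hasLaw {ι Ω E : Type*} [MeasurableSpace Ω] [MeasurableSpace E]
    {ε : ι → Ω → E} {Q : Measure E} {P : Measure Ω} (hindep : iIndepFun ε P)
    (hlaw : ∀ i, HasLaw (ε i) Q P) :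
    IsIID (fun i => (hlaw i).aemeasurable.mk (ε i)) Q P where
  meas i := (hlaw i).aemeasurable.measurable_mk
  indep := hindep.congr fun i => (hlaw i).aemeasurable.ae_eq_mk
  map_eq i := by
    rw [← Measure.map_congr (hlaw i).aemeasurable.ae_eq_mk, (hlaw i).map_eq]

namespace Model

variable {a b d : ℕ} {E : Type*} [MeasurableSpace E] {S : Model a b d E}

lemma drep_eq (α : ℝ) (k : Fin b) (θ : Fin a → ℝ) (φ : Fin b → ℝ) (M N : ℕ) (e : ℕ × ℕ → E) :
    S.drep α k θ φ M N e = (1 / (M : ℝ)) * ∑ m ∈ Finset.range M,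
      rowEstimator α (fun e => S.wt θ φ e φ ^ (1 - α))
        (fun e => S.wt θ φ e φ ^ (1 - α) *
          partialD k (fun φ' => Real.log (S.wt θ φ e φ')) φ)
        (fun e => (S.wt θ φ e φ ^ (1 - α)) ^ 2 *
          partialD k (fun φ' => Real.log (S.wt θ φ e φ')) φ) N (fun j => e (m, j)) := by
  simp only [rowEstimator_eq_sum]
  rfl

namespace Standing

lemma aemeasurable_partialD_log_wt (hS : S.Standing) {θ : Fin a → ℝ} (hθ : θ ∈ S.Θ)
    {φ : Fin b → ℝ} (hφ : φ ∈ S.Φ) (k : Fin b) :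
    AEMeasurable (fun e => partialD k (fun φ' => Real.log (S.wt θ φ e φ')) φ) S.Q := by
  simp only [partialD_eq_deriv]
  refine aemeasurable_deriv_of_ae
    (F := fun t e => Real.log (S.wt θ φ e (Function.update φ k t))) ?_ ?_
  · filter_upwards [hS.update_mem hφ k] with t ht
    exact Real.measurable_log.comp_aemeasurable (hS.aemeasurable_wt hθ hφ ht)
  · filter_upwards [hS.ae_line hθ hφ k] with e he
    obtain ⟨hpos, hd⟩ := (he (φ k) (by rwa [Function.update_eq_self])).1
    exact hd.log hpos.ne'

/-- Every power of the weights is differentiated through the logarithm. This ties the moment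
conditions to the estimator: with `X = w^(1-α)`, the derivative of `X` is `(1-α) A` and that of `X²`
is `2(1-α) B`. -/
lemma ae_partialD_rpow (hS : S.Standing) {θ : Fin a → ℝ} (hθ : θ ∈ S.Θ)
    {φ : Fin b → ℝ} (hφ : φ ∈ S.Φ) (k : Fin b) :
    ∀ᵐ e ∂S.Q, 0 < S.wt θ φ e φ ∧ ∀ c : ℝ,
      HasDerivAt (fun t => S.wt θ φ e (Function.update φ k t) ^ c)
        (c * (S.wt θ φ e φ ^ c * partialD k (fun φ' => Real.log (S.wt θ φ e φ')) φ)) (φ k) := by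
  filter_upwards [hS.ae_line hθ hφ k] with e he
  obtain ⟨hpos, hd⟩ := (he (φ k) (by rwa [Function.update_eq_self])).1
  have hpos' : 0 < S.wt θ φ e φ := by rwa [Function.update_eq_self] at hpos
  refine ⟨hpos', fun c => ?_⟩
  refine (hd.hasDerivAt.rpow_const (p := c) (Or.inl hpos.ne')).congr_deriv ?_
  rw [partialD_eq_deriv, (hd.hasDerivAt.log hpos.ne').deriv, Function.update_eq_self]
  have h5 : S.wt θ φ e φ ^ c = S.wt θ φ e φ ^ (c - 1) * S.wt θ φ e φ := by
    rw [← Real.rpow_add_one hpos'.ne', sub_add_cancel]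
  rw [h5]
  field_simp

end Standing
end Model
end VarInf

/-! ### The theorem -/

open VarInf

theorem theorem3 {a b d : ℕ} {E Ω : Type*} [MeasurableSpace E] [MeasurableSpace Ω]
    (S : VarInf.Model a b d E) (hS : S.Standing)
    (P : Measure Ω) [IsProbabilityMeasure P]
    -- the noise variables: i.i.d. with law `Q`
    (ε : ℕ × ℕ → Ω → E) (hindep : iIndepFun ε P) (hlaw : ∀ i, HasLaw (ε i) S.Q P)
    (α : ℝ) (hα0 : 0 ≤ α) (hα1 : α < 1)
    (θ : Fin a → ℝ) (hθ : θ ∈ S.Θ) (φ : Fin b → ℝ) (hφ : φ ∈ S.Φ) (k : Fin b)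
    -- a negative moment of an empirical mean of weights
    (hneg : ∃ μ : ℝ, 1 < μ ∧ ∃ n : ℕ, 1 ≤ n ∧
      Integrable (fun ω => |(1 / (n : ℝ)) *
        ∑ j ∈ Finset.range n, S.wt θ φ (ε (0, j) ω) φ ^ (1 - α)| ^ (-μ)) P)
    -- moment conditions
    (h : ℝ) (hh : 2 < h)
    (hmom : Integrable (fun e => S.wt θ φ e φ ^ ((1 - α) * h)) S.Q)
    (ht : ℝ) (hht : 2 < ht)
    (hmomT : Integrable (fun e =>
      |VarInf.partialD k (fun φ' => S.wt θ φ e φ' ^ (2 * (1 - α))) φ| ^ ht) S.Q)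
    (hdom : S.DrepDomination α k) :
    (0 < α →
      ∀ h' : ℝ, 2 < h' →
      Integrable (fun e =>
        |VarInf.partialD k (fun φ' => S.wt θ φ e φ' ^ (1 - α)) φ| ^ h') S.Q →
      VarInf.HasPartialD k (S.VR α θ) φ ∧
      (∀ᵐ e ∂S.Q, VarInf.HasPartialD k (fun φ' =>
        S.wt θ φ e φ' ^ (1 - α) / ∫ e', S.wt θ φ e' φ' ^ (1 - α) ∂S.Q) φ) ∧
      MemLp (S.drepVar α k θ φ) 2 S.Q ∧
      ∃ r s : ℕ → ℝ, Tendsto r atTop (𝓝 0) ∧ Tendsto s atTop (𝓝 0) ∧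
        ∀ᶠ N : ℕ in atTop, 0 ≤ Real.sqrt (S.vDrep α k θ φ) + s N ∧
          ∀ M : ℕ, 1 ≤ M →
            MemLp (fun ω => S.drep α k θ φ M N (fun i => ε i ω)) 2 P ∧
            VarInf.snr P (fun ω => S.drep α k θ φ M N (fun i => ε i ω)) =
              ENNReal.ofReal (Real.sqrt ((M : ℝ) * N)) *
                (ENNReal.ofReal |VarInf.partialD k (S.VR α θ) φ + r N| /
                  ENNReal.ofReal (Real.sqrt (S.vDrep α k θ φ) + s N))) ∧
    (α = 0 →
      VarInf.HasPartialD k (S.gammaSq 0 θ) φ ∧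
      MemLp (S.drepVarZero k θ φ) 2 S.Q ∧
      ∃ r s : ℕ → ℝ, Tendsto r atTop (𝓝 0) ∧ Tendsto s atTop (𝓝 0) ∧
        ∀ᶠ N : ℕ in atTop, 0 ≤ Real.sqrt (S.vDrepZero k θ φ) + s N ∧
          ∀ M : ℕ, 1 ≤ M →
            MemLp (fun ω => S.drep 0 k θ φ M N (fun i => ε i ω)) 2 P ∧
            VarInf.snr P (fun ω => S.drep 0 k θ φ M N (fun i => ε i ω)) =
              ENNReal.ofReal (Real.sqrt ((M : ℝ) * N)) *
                (ENNReal.ofReal |(1 / 2) * VarInf.partialD k (S.gammaSq 0 θ) φ + r N| /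
                  ENNReal.ofReal (Real.sqrt (S.vDrepZero k θ φ) + s N))) := by
  have := hS.isProb
  have hα : 1 - α ≠ 0 := by linarith
  -- measurable versions of the noise and of the three functions of the noise
  set X₀ : E → ℝ := fun e => S.wt θ φ e φ ^ (1 - α) with hX₀
  set D : E → ℝ := fun e => partialD k (fun φ' => Real.log (S.wt θ φ e φ')) φ with hD
  have hline := hS.ae_partialD_rpow hθ hφ k
  have hX₀m : AEMeasurable X₀ S.Q := (hS.aemeasurable_wt hθ hφ hφ).pow_const _
  have hDm : AEMeasurable D S.Q := hS.aemeasurable_partialD_log_wt hθ hφ k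
  have hX₀pos : ∀ᵐ e ∂S.Q, 0 < X₀ e := by
    filter_upwards [hline] with e he using Real.rpow_pos_of_pos he.1 _
  have hA₀m : AEMeasurable (fun e => X₀ e * D e) S.Q := hX₀m.mul hDm
  have hB₀m : AEMeasurable (fun e => X₀ e ^ 2 * D e) S.Q := (hX₀m.pow_const 2).mul hDm
  obtain ⟨X, hX, hX0, hXX₀⟩ := exists_measurable_pos hX₀m hX₀pos
  obtain ⟨A, hA, hAA₀⟩ := hA₀m
  obtain ⟨B, hB, hBB₀⟩ := hB₀m
  have hε := IsIID.mk_of_hasLaw hindep hlaw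
  set ε' : ℕ × ℕ → Ω → E := fun i => (hlaw i).aemeasurable.mk (ε i) with hε'
  -- Countably many noise variables, hence a single null set outside which all measurable versions
  -- agree with the original quantities.
  have hεε' : ∀ᵐ ω ∂P, ∀ i, X₀ (ε i ω) = X (ε' i ω) ∧
      X₀ (ε i ω) * D (ε i ω) = A (ε' i ω) ∧ X₀ (ε i ω) ^ 2 * D (ε i ω) = B (ε' i ω) := by
    rw [ae_all_iff]
    intro i
    have h1 : ∀ᵐ e ∂S.Q, X e = X₀ e ∧ X₀ e * D e = A e ∧ X₀ e ^ 2 * D e = B e := by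
      filter_upwards [hXX₀, hAA₀, hBB₀] with e h1 h2 h3 using ⟨h1, h2, h3⟩
    rw [← (hlaw i).map_eq] at h1
    filter_upwards [ae_of_ae_map (hlaw i).aemeasurable h1, (hlaw i).aemeasurable.ae_eq_mk]
      with ω h2 h3
    rw [hε']
    dsimp only
    rw [← h3]
    exact ⟨h2.1.symm, h2.2.1, h2.2.2⟩
  have hdrep : ∀ M N : ℕ, (fun ω => S.drep α k θ φ M N (fun i => ε i ω)) =ᵐ[P]
      fun ω => (1 / (M : ℝ)) * ∑ m ∈ Finset.range M,
        tupleEstimator α X A B N (fun i => ε' (m, i) ω) := by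
    intro M N
    filter_upwards [hεε'] with ω hω
    rw [Model.drep_eq]
    congr 1
    refine Finset.sum_congr rfl fun m _ => ?_
    rw [← rowEstimator_eq_tupleEstimator α X A B N (fun j => ε' (m, j) ω)]
    exact rowEstimator_congr (fun j => (hω (m, j)).1) (fun j => (hω (m, j)).2.1)
      (fun j => (hω (m, j)).2.2)
  -- moments
  have hX2 : MemLp X 2 S.Q := by
    refine memLp_two_of_integrable_rpow hX.aemeasurable hh (hmom.congr ?_)
    filter_upwards [hXX₀, hline] with e h1 h2
    rw [abs_of_pos (hX0 e), h1, hX₀]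
    exact Real.rpow_mul h2.1.le _ _
  have hB2 : MemLp B 2 S.Q := by
    have h1 : MemLp (fun e => 2 * (1 - α) * B e) 2 S.Q := by
      refine memLp_two_of_integrable_rpow (hB.const_mul _).aemeasurable hht (hmomT.congr ?_)
      filter_upwards [hBB₀, hline] with e h1 h2
      rw [partialD_eq_deriv, (h2.2 _).deriv, ← h1, mul_comm 2 (1 - α),
        Real.rpow_mul h2.1.le, Real.rpow_two]
    refine (h1.const_mul (2 * (1 - α))⁻¹).ae_eq (Eventually.of_forall fun e => ?_)
    exact inv_mul_cancel_left₀ (by simpa using hα) _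
  have hx : 0 < ∫ e, X e ∂S.Q := by
    rw [integral_pos_iff_support_of_nonneg (fun e => (hX0 e).le) (hX2.integrable (by norm_num))]
    have : Function.support X = Set.univ := Set.eq_univ_of_forall fun e => (hX0 e).ne'
    simp [this]
  have hxX₀ : ∫ e, X₀ e ∂S.Q = ∫ e, X e ∂S.Q := integral_congr_ae hXX₀.symm
  have hX₀int : Integrable X₀ S.Q := (hX2.integrable (by norm_num)).congr hXX₀
  obtain ⟨μ, hμ, n, hn, hnegint⟩ := hneg
  have hneg' : ∫⁻ ω, ENNReal.ofReal (∑ l ∈ Finset.range n, X (ε' (0, l) ω))⁻¹ ∂P ≠ ⊤ := by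
    refine (hε.row 0).lintegral_inv_sum_ne_top hX hX0 hμ hn (hnegint.congr ?_)
    filter_upwards [hεε'] with ω hω
    congr 3
    exact Finset.sum_congr rfl fun j _ => (hω (0, j)).1
  obtain ⟨V, hVsub, hVn, hdom1, hdom2⟩ := hdom θ hθ φ hφ
  constructor
  · intro hα0' h' hh' hmom'
    obtain ⟨-, hH2, hH1, -⟩ :=
      hS.hasDerivAt_moments hθ hφ hVsub hVn (hdom1 hα0') hX₀int
    have hPA : (fun e => partialD k (fun φ' => S.wt θ φ e φ' ^ (1 - α)) φ) =ᵐ[S.Q]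
        fun e => (1 - α) * A e := by
      filter_upwards [hAA₀, hline] with e h1 h2
      rw [partialD_eq_deriv, (h2.2 _).deriv, ← h1]
    have hA2 : MemLp A 2 S.Q := by
      have h1 : MemLp (fun e => (1 - α) * A e) 2 S.Q := by
        refine memLp_two_of_integrable_rpow (hA.const_mul _).aemeasurable hh' (hmom'.congr ?_)
        filter_upwards [hPA] with e h1
        rw [h1]
      refine (h1.const_mul (1 - α)⁻¹).ae_eq (Eventually.of_forall fun e => ?_)
      exact inv_mul_cancel_left₀ hα _
    have hPAint : ∫ e, partialD k (fun φ' => S.wt θ φ e φ' ^ (1 - α)) φ ∂S.Q =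
        (1 - α) * ∫ e, A e ∂S.Q := by
      rw [integral_congr_ae hPA, integral_const_mul]
    -- The factor `1 - α` of the derivative of `w^(1-α)` cancels that of the bound, leaving `α a/x`,
    -- the limiting mean of a row.
    have hVR := hS.hasDerivAt_VR hθ hφ hα1 (by change 0 < ∫ e, X₀ e ∂S.Q; rwa [hxX₀]) hH1
    rw [hPAint, mul_div_cancel_left₀ _ hα] at hVR
    change HasDerivAt _ (α * (∫ e, A e ∂S.Q) / ∫ e, X₀ e ∂S.Q) _ at hVR
    rw [hxX₀] at hVR
    have hH2k : ∫ e', S.wt θ φ e' (Function.update φ k (φ k)) ^ (1 - α) ∂S.Q =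
        ∫ e, X e ∂S.Q := by
      rw [Function.update_eq_self]; exact hxX₀
    have hquot : ∀ᵐ e ∂S.Q, HasDerivAt (fun t => S.wt θ φ e (Function.update φ k t) ^ (1 - α) /
        ∫ e', S.wt θ φ e' (Function.update φ k t) ^ (1 - α) ∂S.Q)
        ((1 - α) * (A e / (∫ e, X e ∂S.Q) -
          X e * (∫ e, A e ∂S.Q) / (∫ e, X e ∂S.Q) ^ 2)) (φ k) := by
      filter_upwards [hAA₀, hXX₀, hline] with e h1 h2 h3
      refine ((h3.2 (1 - α)).div hH2 (by rw [hH2k]; exact hx.ne')).congr_deriv ?_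
      rw [hH2k, hPAint, Function.update_eq_self, ← h1, h2]
      simp only [hX₀, hD]
      field_simp
    have hdv : S.drepVar α k θ φ =ᵐ[S.Q] fun e => (1 - α) * (A e / (∫ e, X e ∂S.Q) -
        X e * (∫ e, A e ∂S.Q) / (∫ e, X e ∂S.Q) ^ 2) := by
      filter_upwards [hquot] with e he using he.deriv
    have hvv : S.vDrep α k θ φ = α ^ 2 * variance (fun e => A e / (∫ e, X e ∂S.Q) -
        X e * (∫ e, A e ∂S.Q) / (∫ e, X e ∂S.Q) ^ 2) S.Q := by
      rw [Model.vDrep, variance_congr hdv, variance_const_mul, ← mul_assoc,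
        div_mul_cancel₀ _ (pow_ne_zero 2 hα)]
    refine ⟨hVR.differentiableAt, ?_, ?_, ?_⟩
    · filter_upwards [hquot] with e he using he.differentiableAt
    · refine MemLp.ae_eq hdv.symm (MemLp.const_mul ?_ _)
      simp only [div_eq_mul_inv, mul_assoc]
      exact (hA2.mul_const _).sub (hX2.mul_const _)
    · obtain ⟨h1, h2, h3⟩ := (hε.row 0).rowEstimator_asymptotics hX hX0 hX2 hx hA hA2 hB hB2 hn
        hneg' α
      rw [← hvv] at h3
      simp only [rowEstimator_eq_tupleEstimator] at h1 h2 h3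
      obtain ⟨r, s, hr, hs, hev⟩ := hε.exists_snr_eq (c := fun _ => 1)
        (measurable_tupleEstimator α hX hA hB) (fun _ _ => one_pos)
        (κ := α * (∫ e, A e ∂S.Q) / ∫ e, X e ∂S.Q) (κ' := partialD k (S.VR α θ) φ)
        (by rw [partialD_eq_deriv, hVR.deriv]) (by simpa only [one_mul] using h1)
        (by simpa only [one_mul] using h2) (by simpa only [one_mul] using h3)
      refine ⟨r, s, hr, hs, hev.mono fun N hN => ⟨hN.1, fun M hM => ?_⟩⟩
      exact ⟨(hN.2 M hM).1.ae_eq (hdrep M N).symm,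
        (snr_congr (hdrep M N)).trans (hN.2 M hM).2⟩
  · rintro rfl
    have hX₀eq : X₀ = fun e => S.wt θ φ e φ := by
      funext e; simp [hX₀]
    have hint2 : Integrable (fun e => S.wt θ φ e φ ^ (2 : ℝ)) S.Q := by
      refine hX2.integrable_sq.congr ?_
      filter_upwards [hXX₀] with e h1
      rw [h1, hX₀eq, Real.rpow_two]
    obtain ⟨-, -, hH1, hH1int⟩ :=
      hS.hasDerivAt_moments hθ hφ hVsub hVn (hdom2 rfl) hint2
    have hPB : (fun e => partialD k (fun φ' => S.wt θ φ e φ' ^ (2 : ℝ)) φ) =ᵐ[S.Q]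
        fun e => 2 * B e := by
      filter_upwards [hBB₀, hline] with e h1 h2
      rw [partialD_eq_deriv, (h2.2 _).deriv, ← h1, hX₀eq, Real.rpow_two]
    have hPBint : ∫ e, partialD k (fun φ' => S.wt θ φ e φ' ^ (2 : ℝ)) φ ∂S.Q =
        2 * ∫ e, B e ∂S.Q := by
      rw [integral_congr_ae hPB, integral_const_mul]
    have hwt : ∫ e, S.wt θ φ e φ ∂S.Q = ∫ e, X e ∂S.Q := by
      rw [← hxX₀, hX₀eq]
    have hγ := hS.hasDerivAt_gammaSq_zero hθ hφ hH1 hH1int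
    rw [hPBint, hwt] at hγ
    have hdv : S.drepVarZero k θ φ =ᵐ[S.Q] fun e => B e / (∫ e, X e ∂S.Q) ^ 2 -
        X e * (2 * ∫ e, B e ∂S.Q) / (∫ e, X e ∂S.Q) ^ 3 := by
      filter_upwards [hPB, hXX₀] with e h1 h2
      rw [Model.drepVarZero, h1, hPBint, hwt, h2, hX₀eq, mul_div_mul_left _ _ two_ne_zero]
    have hvv : S.vDrepZero k θ φ = variance (fun e => B e / (∫ e, X e ∂S.Q) ^ 2 -
        X e * (2 * ∫ e, B e ∂S.Q) / (∫ e, X e ∂S.Q) ^ 3) S.Q := variance_congr hdv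
    refine ⟨hγ.differentiableAt, ?_, ?_⟩
    · refine MemLp.ae_eq hdv.symm ?_
      simp only [div_eq_mul_inv, mul_assoc]
      exact (hB2.mul_const _).sub (hX2.mul_const _)
    · obtain ⟨h1, h2, h3⟩ := (hε.row 0).rowEstimator_zero_asymptotics (A := A) hX hX0 hX2 hx hB hB2
        hn hneg'
      rw [← hvv] at h3
      simp only [rowEstimator_eq_tupleEstimator] at h1 h2 h3
      -- Mean and standard deviation of a row are rescaled by `N`, which does not affect their
      -- ratio. The limiting mean is `b/x²`, the opposite of `½ ∂γ²`.
      obtain ⟨r, s, hr, hs, hev⟩ := hε.exists_snr_eq (c := fun N => (N : ℝ))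
        (measurable_tupleEstimator 0 hX hA hB) (fun N hN => by exact_mod_cast hN)
        (κ' := (1 / 2) * partialD k (S.gammaSq 0 θ) φ)
        (by
          rw [partialD_eq_deriv, hγ.deriv, ← abs_neg]
          congr 1
          ring) h1 h2 h3
      refine ⟨r, s, hr, hs, hev.mono fun N hN => ⟨hN.1, fun M hM => ?_⟩⟩
      exact ⟨(hN.2 M hM).1.ae_eq (hdrep M N).symm,
        (snr_congr (hdrep M N)).trans (hN.2 M hM).2⟩
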